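/- Let $Q_6$ be the 6-dimensional hypercube: its vertex set is $\{0,1\}^6$, and two vertices are adjacent if and only if they differ in exactly one coordinate. It has 192 edges and exactly 240 four-cycles; let $\mathcal{C}_6$ be the set of these four-cycles, each regarded as a set of four edges. Consider the 0/1 integer linear program \[ \max \sum_{e\in E(Q_6)} x_e \quad\text{subject to}\quad \sum_{e\in C} x_e\le 3 \ \text{ for all } C\in\mathcal{C}_6, \qquad x_e\in\{0,1\}\ \text{ for all } e\in E(Q_6). \] Let $\mathrm{ex}(Q_6,C_4)$ denote the maximum number of edges in a subgraph of $Q_6$ that contains no four-cycle. Then the optimal value of the program is $132$, and $\mathrm{ex}(Q_6,C_4)\le 132$. Moreover, there is a subgraph of $Q_6$ with exactly $132$ edges that contains no four-cycle, and hence $\mathrm{ex}(Q_6,C_4)=132$. -/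

import Mathlib

/-- The `n`-dimensional hypercube `Q_n`: the vertices are the 0/1 vectors of length `n`, and two
vertices are adjacent iff they differ in exactly one coordinate. -/
def hypercube (n : ℕ) : SimpleGraph (Fin n → Bool) where
  Adj u v := hammingDist u v = 1
  symm := ⟨fun u v h => by rw [hammingDist_comm]; exact h⟩
  loopless := ⟨fun u h => by simp at h⟩

instance (n : ℕ) : DecidableRel (hypercube n).Adj :=
  fun u v => inferInstanceAs (Decidable (hammingDist u v = 1))

/-- The four-cycles of a graph `G`, each given by its set of four edges
`{ab, bc, cd, da}`; the conditions `a ≠ c` and `b ≠ d` (together with adjacency) say that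
`a, b, c, d` are four distinct vertices. -/
def fourCycles {V : Type*} [DecidableEq V] (G : SimpleGraph V) : Set (Finset G.edgeSet) :=
  {C | ∃ (a b c d : V) (hab : G.Adj a b) (hbc : G.Adj b c) (hcd : G.Adj c d) (hda : G.Adj d a),
    a ≠ c ∧ b ≠ d ∧
    C = {⟨s(a, b), hab⟩, ⟨s(b, c), hbc⟩, ⟨s(c, d), hcd⟩, ⟨s(d, a), hda⟩}}

/-- Feasible points of the 0/1 integer linear program of `G`: one binary variable for each edge,
and for each four-cycle the constraint that its four variables sum to at most `3`. -/
def IsFeasibleILP {V : Type*} [DecidableEq V] (G : SimpleGraph V) (x : G.edgeSet → ℤ) : Prop :=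
  (∀ e, x e = 0 ∨ x e = 1) ∧ ∀ C ∈ fourCycles G, ∑ e ∈ C, x e ≤ 3

/-- `ex(G, H)`: the maximum number of edges in an `H`-free subgraph of the finite graph `G`.
(Isolated vertices do not affect the number of edges, so spanning subgraphs suffice here.) -/
noncomputable def exIn {V W : Type*} [Finite V] (G : SimpleGraph V) (H : SimpleGraph W) : ℕ :=
  sSup {m : ℕ | ∃ G' : SimpleGraph V, G' ≤ G ∧ H.Free G' ∧ G'.edgeSet.ncard = m}

namespace SquareFree

/-! ### Bit masks and the branching search -/

/-! A subgraph of the cube has no four-cycle exactly when the set of removed edges meets every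
four-cycle, and feasible 0/1 points are the indicators of such subgraphs. So everything reduces to
the least size of a hitting set among the 192 edges: `witness` has 60 edges, and `sixty_le` shows
that no hitting set is smaller.

The lower bound climbs through the dimensions. In dimension four, a hitting set of at most 9 edges
contains one of eight translates of a perfect pattern of 8 edges (`exists_pattern`). In dimension
five, the ten four-dimensional faces cover each edge four times, so a hitting set of at most 24
edges has two faces with at most 9. A search from the patterns on such faces gives exactly 24 edges,
evenly many in each direction (`isTight`), and exactly 8 edges on every face with at most 9
(`cnt_w4_le`, `eight_le_face`).

In dimension six, suppose that at most 59 edges suffice, and let direction 0 carry the most edges.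
Both halves in every direction have at least 24 edges, so no direction has more than 11. Since the
six direction counts add up to the total, the total is 58 or 59, direction 0 has at least 10 edges,
and the lighter half in direction 0 has exactly 24. Parity and counting then give the conditions
`IsSparse`: at most 7 edges per direction in that half, and at most one other direction with both
halves above 24. The 24-edge half contains two crossing perfect patterns, so up to symmetry it is
one of a finite list of leaves. Each leaf already has 8 edges in some direction, or else cannot be
extended by light halves in all but one of the other directions within a budget of 59
(`leaves_refuted`, `not_isSparse`).

The searches are evaluated by the kernel; `exists_mem_solve` shows that they lose no hitting set. -/

/-- A four-cycle, given by the union of its four edge bits and by the single bits. -/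
structure Square where
  mask : ℕ
  e₁ : ℕ
  e₂ : ℕ
  e₃ : ℕ
  e₄ : ℕ

/-- The binary digits of a mask stand for edges. Raw operations such as `Nat.land`, and explicit
recursors, keep the kernel evaluation of the searches close to arithmetic on numerals. -/
def disjoint (m n : ℕ) : Bool := Nat.beq (Nat.land m n) (nat_lit 0)

/-- Branches over the edges of the squares not yet met by `inn`, adding at most `bud` edges and
never one of `out`; the list of all final pairs of included and excluded edges. -/
def solve (cs : List Square) : ℕ → ℕ → ℕ → List (ℕ × ℕ) :=
  cs.rec (fun inn out _ => [(inn, out)]) fun c _ rest inn out bud =>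
    match disjoint c.mask inn with
    | false => rest inn out bud
    -- With no budget left, an unmet square closes the node. Otherwise the four branches guess the
    -- first edge of the square that is used, and exclude the edges before it.
    | true => Nat.rec [] (fun b _ =>
      let branch (e o : ℕ) : List (ℕ × ℕ) :=
        match disjoint e out with
        | true => rest (Nat.lor inn e) o b
        | false => []
      branch c.e₁ out ++ (branch c.e₂ (Nat.lor out c.e₁) ++
        (branch c.e₃ (Nat.lor (Nat.lor out c.e₁) c.e₂) ++
          branch c.e₄ (Nat.lor (Nat.lor (Nat.lor out c.e₁) c.e₂) c.e₃)))) bud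

/-- A lower bound for the number of binary ones. -/
def pop : ℕ → ℕ → ℕ
  | 0, _ => 0
  | k + 1, n => bif Nat.beq n (nat_lit 0) then 0 else Nat.succ (pop k (Nat.land n (Nat.sub n 1)))

/-- The edges of `m` already included are charged to the budget beforehand; an inconsistent or
overspent start yields no leaves. -/
def solveFrom (cs : List Square) (m bud inn out : ℕ) : List (ℕ × ℕ) :=
  bif disjoint inn out then
    let p := pop 400 (Nat.land inn m)
    bif Nat.ble p bud then
      solve (cs.filter fun c => disjoint c.mask inn) inn out (Nat.sub bud p) else []
  else []

theorem disjoint_iff (m n : ℕ) :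
    disjoint m n = true ↔ ∀ e, m.testBit e = true → n.testBit e = true → False := by
  have h : disjoint m n = true ↔ m &&& n = 0 := by
    unfold disjoint
    exact ⟨fun h => Nat.eq_of_beq_eq_true h, fun h => by
      change Nat.beq (m &&& n) 0 = true
      rw [h]; rfl⟩
  rw [h]
  constructor
  · intro h0 e h1 h2
    have := congrArg (fun k => Nat.testBit k e) h0
    simp [Nat.testBit_and, h1, h2] at this
  · intro h0
    apply Nat.eq_of_testBit_eq
    intro e
    rw [Nat.testBit_and, Nat.zero_testBit]
    have := h0 e
    cases h1 : m.testBit e <;> cases h2 : n.testBit e <;> simp_all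

def Agrees (P : ℕ → Bool) (inn out : ℕ) : Prop :=
  (∀ e, inn.testBit e = true → P e = true) ∧ ∀ e, out.testBit e = true → P e = false

/-- The number of edges in the mask `m` belonging to `P`. -/
def load (P : ℕ → Bool) (m : ℕ) : ℕ :=
  ((Finset.range 384).filter fun e => m.testBit e = true ∧ P e = true).card

def Covered (P : ℕ → Bool) (m : ℕ) (c : Square) : Prop :=
  ∃ a₁ a₂ a₃ a₄, c.e₁ = 2 ^ a₁ ∧ c.e₂ = 2 ^ a₂ ∧ c.e₃ = 2 ^ a₃ ∧ c.e₄ = 2 ^ a₄ ∧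
    (∀ a ∈ [a₁, a₂, a₃, a₄], c.mask.testBit a = true ∧ m.testBit a = true ∧ a < 384) ∧
    (P a₁ = true ∨ P a₂ = true ∨ P a₃ = true ∨ P a₄ = true)

theorem testBit_pow (a e : ℕ) : (2 ^ a).testBit e = true ↔ a = e := by
  rw [Nat.testBit_two_pow]; simp

theorem testBit_lor (m n e : ℕ) : (Nat.lor m n).testBit e = true ↔
    m.testBit e = true ∨ n.testBit e = true := by
  change (m ||| n).testBit e = true ↔ _
  rw [Nat.testBit_or]; simp

theorem testBit_land (m n e : ℕ) : (Nat.land m n).testBit e = true ↔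
    m.testBit e = true ∧ n.testBit e = true := by
  change (m &&& n).testBit e = true ↔ _
  rw [Nat.testBit_and]; simp

theorem Agrees.lor {P : ℕ → Bool} {a b c d : ℕ} (h : Agrees P a b) (h' : Agrees P c d) :
    Agrees P (Nat.lor a c) (Nat.lor b d) := by
  refine ⟨fun e he => ?_, fun e he => ?_⟩ <;> rw [testBit_lor] at he
  · exact he.elim (h.1 e) (h'.1 e)
  · exact he.elim (h.2 e) (h'.2 e)

theorem Agrees.disjoint {P : ℕ → Bool} {a b : ℕ} (h : Agrees P a b) : disjoint a b = true := by
  rw [disjoint_iff]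
  intro e h1 h2
  have := h.1 e h1
  rw [h.2 e h2] at this
  cases this

theorem Agrees.inn {P : ℕ → Bool} {a b e : ℕ} (h : Agrees P a b) (he : P e = true) :
    Agrees P (Nat.lor a (2 ^ e)) b := by
  refine ⟨fun x hx => ?_, h.2⟩
  rw [testBit_lor, testBit_pow] at hx
  exact hx.elim (h.1 x) fun h => h ▸ he

theorem Agrees.out {P : ℕ → Bool} {a b e : ℕ} (h : Agrees P a b) (he : ¬ P e = true) :
    Agrees P a (Nat.lor b (2 ^ e)) := by
  refine ⟨h.1, fun x hx => ?_⟩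
  rw [testBit_lor, testBit_pow] at hx
  exact hx.elim (h.2 x) fun h => by subst h; simpa using he

def branch (cs : List Square) (inn out bud e o : ℕ) : List (ℕ × ℕ) :=
  match disjoint e out with
  | true => solve cs (Nat.lor inn e) o bud
  | false => []

theorem solve_cons_of_not_disjoint {c : Square} {inn : ℕ} (h : disjoint c.mask inn = false)
    (cs : List Square) (out bud : ℕ) : solve (c :: cs) inn out bud = solve cs inn out bud := by
  change (match disjoint c.mask inn with | false => solve cs inn out bud | true => _) = _
  rw [h]

theorem solve_cons_of_disjoint {c : Square} {inn : ℕ} (h : disjoint c.mask inn = true)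
    (cs : List Square) (out b : ℕ) : solve (c :: cs) inn out (b + 1) =
      branch cs inn out b c.e₁ out ++ (branch cs inn out b c.e₂ (Nat.lor out c.e₁) ++
        (branch cs inn out b c.e₃ (Nat.lor (Nat.lor out c.e₁) c.e₂) ++
          branch cs inn out b c.e₄ (Nat.lor (Nat.lor (Nat.lor out c.e₁) c.e₂) c.e₃))) := by
  change (match disjoint c.mask inn with | false => solve cs inn out (b + 1) | true => _) = _
  rw [h]
  rfl

/-- At each unmet square, follow the branch of its first edge in `P`. The edges before it are
rightly excluded, and the new edge lies in `m` and in `P`, so the set bounded by the budget shrinks.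
-/
theorem exists_mem_solve (P : ℕ → Bool) (m : ℕ) (cs : List Square)
    (hcs : ∀ c ∈ cs, Covered P m c) (inn out bud : ℕ) (h : Agrees P inn out)
    (hb : ((Finset.range 384).filter fun e =>
      m.testBit e = true ∧ P e = true ∧ ¬ inn.testBit e = true).card ≤ bud) :
    ∃ r ∈ solve cs inn out bud, Agrees P r.1 r.2 := by
  induction cs generalizing inn out bud with
  | nil => exact ⟨(inn, out), List.mem_singleton.2 rfl, h⟩
  | cons c cs ih =>
    have ih := ih fun c hc => hcs c (List.mem_cons_of_mem _ hc)
    obtain ⟨a₁, a₂, a₃, a₄, h₁, h₂, h₃, h₄, hm, hP⟩ := hcs c List.mem_cons_self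
    cases hd : disjoint c.mask inn with
    | false =>
      rw [solve_cons_of_not_disjoint hd]
      exact ih inn out bud h hb
    | true =>
      have hd' := (disjoint_iff _ _).1 hd
      have key : ∀ a ∈ [a₁, a₂, a₃, a₄], P a = true → ∀ o, Agrees P inn o →
          ∃ b, bud = b + 1 ∧ ∃ r ∈ solve cs (Nat.lor inn (2 ^ a)) o b, Agrees P r.1 r.2 := by
        intro a ha hPa o ho
        have hna : ¬ inn.testBit a = true := fun h' => hd' a (hm a ha).1 h'
        have hlt : ((Finset.range 384).filter fun e =>
            m.testBit e = true ∧ P e = true ∧ ¬ (Nat.lor inn (2 ^ a)).testBit e = true).card <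
            ((Finset.range 384).filter fun e =>
              m.testBit e = true ∧ P e = true ∧ ¬ inn.testBit e = true).card := by
          apply Finset.card_lt_card
          rw [Finset.ssubset_iff_of_subset]
          · refine ⟨a, ?_, ?_⟩
            · simp only [Finset.mem_filter, Finset.mem_range]
              exact ⟨(hm a ha).2.2, (hm a ha).2.1, hPa, hna⟩
            · simp only [Finset.mem_filter, testBit_lor, testBit_pow]
              tauto
          · intro e he
            simp only [Finset.mem_filter, testBit_lor] at he ⊢
            tauto
        obtain ⟨b, rfl⟩ : ∃ b, bud = b + 1 := ⟨bud - 1, by omega⟩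
        exact ⟨b, rfl, ih _ o b (ho.inn hPa) (by omega)⟩
      have hdis : ∀ a, P a = true → disjoint (2 ^ a) out = true := by
        intro a ha
        rw [disjoint_iff]
        intro e he ho
        rw [testBit_pow] at he
        subst he
        have := h.2 _ ho
        rw [ha] at this
        cases this
      by_cases p₁ : P a₁ = true
      · obtain ⟨b, rfl, r, hr, hr'⟩ := key a₁ (by simp) p₁ out h
        refine ⟨r, ?_, hr'⟩
        rw [solve_cons_of_disjoint hd]; simp only [branch, h₁, hdis a₁ p₁]
        exact List.mem_append_left _ hr
      have g₁ := h.out p₁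
      by_cases p₂ : P a₂ = true
      · obtain ⟨b, rfl, r, hr, hr'⟩ := key a₂ (by simp) p₂ _ g₁
        refine ⟨r, ?_, hr'⟩
        rw [solve_cons_of_disjoint hd]; simp only [branch, h₁, h₂, hdis a₂ p₂]
        exact List.mem_append_right _ (List.mem_append_left _ hr)
      have g₂ := g₁.out p₂
      by_cases p₃ : P a₃ = true
      · obtain ⟨b, rfl, r, hr, hr'⟩ := key a₃ (by simp) p₃ _ g₂
        refine ⟨r, ?_, hr'⟩
        rw [solve_cons_of_disjoint hd]; simp only [branch, h₁, h₂, h₃, hdis a₃ p₃]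
        exact List.mem_append_right _ (List.mem_append_right _ (List.mem_append_left _ hr))
      have p₄ : P a₄ = true := by tauto
      obtain ⟨b, rfl, r, hr, hr'⟩ := key a₄ (by simp) p₄ _ (g₂.out p₃)
      refine ⟨r, ?_, hr'⟩
      rw [solve_cons_of_disjoint hd]; simp only [branch, h₁, h₂, h₃, h₄, hdis a₄ p₄]
      exact List.mem_append_right _ (List.mem_append_right _ (List.mem_append_right _ hr))

/-- Passing to `n &&& (n - 1)` loses at least one digit, which pays for the unit counted; running
out of fuel only lowers the result. -/
theorem pop_le (k n : ℕ) (hn : n < 2 ^ 384) :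
    pop k n ≤ ((Finset.range 384).filter fun e => n.testBit e = true).card := by
  induction k generalizing n with
  | zero => exact Nat.zero_le _
  | succ k ih =>
    unfold pop
    cases h0 : Nat.beq n (nat_lit 0) with
    | true => exact Nat.zero_le _
    | false =>
      have hn0 : n ≠ 0 := by
        rintro rfl
        cases h0
      change Nat.succ (pop k (n &&& (n - 1))) ≤ _
      have hle : n &&& (n - 1) ≤ n - 1 := Nat.and_le_right
      refine lt_of_le_of_lt (ih _ (lt_of_le_of_lt Nat.and_le_left hn)) (Finset.card_lt_card ?_)
      refine lt_of_le_of_ne ?_ ?_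
      · intro e he
        simp only [Finset.mem_filter] at he ⊢
        exact ⟨he.1, ((testBit_land n (n - 1) e).1 he.2).1⟩
      · intro heq
        have : n &&& (n - 1) = n := by
          apply Nat.eq_of_testBit_eq
          intro e
          by_cases he : e < 384
          · have := congrArg (e ∈ ·) heq
            simp only [Finset.mem_filter, Finset.mem_range, he, true_and, eq_iff_iff] at this
            exact Bool.eq_iff_iff.2 this
          · have h2 : n < 2 ^ e :=
              lt_of_lt_of_le hn (Nat.pow_le_pow_right (by norm_num) (not_lt.1 he))
            rw [Nat.testBit_lt_two_pow h2,
              Nat.testBit_lt_two_pow (lt_of_le_of_lt Nat.and_le_left h2)]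
        omega

theorem pop_le_load {P : ℕ → Bool} {m n k : ℕ} (hm : m < 2 ^ 384)
    (h : ∀ e, n.testBit e = true → P e = true) : pop k (Nat.land n m) ≤ load P m := by
  refine (pop_le k (Nat.land n m) (lt_of_le_of_lt (Nat.and_le_right (n := n)) hm)).trans
    (Finset.card_le_card ?_)
  intro e he
  simp only [Finset.mem_filter, testBit_land] at he ⊢
  exact ⟨he.1, he.2.2, h e he.2.1⟩

theorem exists_mem_solveFrom {P : ℕ → Bool} {m : ℕ} (hm : m < 2 ^ 384) {cs : List Square}
    (hcs : ∀ c ∈ cs, Covered P m c) {inn out bud : ℕ} (h : Agrees P inn out)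
    (hb : load P m ≤ bud) : ∃ r ∈ solveFrom cs m bud inn out, Agrees P r.1 r.2 := by
  have hp : pop 400 (Nat.land inn m) ≤ _ :=
    pop_le 400 _ (lt_of_le_of_lt (Nat.and_le_right (n := inn)) hm)
  have hsplit : load P m = ((Finset.range 384).filter fun e =>
      m.testBit e = true ∧ P e = true ∧ ¬ inn.testBit e = true).card +
      ((Finset.range 384).filter fun e => (Nat.land inn m).testBit e = true).card := by
    unfold load
    rw [← Finset.card_union_of_disjoint]
    · congr 1
      ext e
      simp only [Finset.mem_filter, Finset.mem_union, testBit_land]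
      have := h.1 e
      tauto
    · rw [Finset.disjoint_left]
      intro e he
      simp only [Finset.mem_filter, testBit_land] at he ⊢
      tauto
  unfold solveFrom
  rw [h.disjoint]
  have hle : Nat.ble (pop 400 (Nat.land inn m)) bud = true := by
    rw [Nat.ble_eq]; omega
  simp only [cond_true, hle]
  refine exists_mem_solve P m _ (fun c hc => hcs c (List.mem_filter.1 hc).1) inn out _ h ?_
  change _ ≤ bud - pop 400 (Nat.land inn m)
  omega

/-- If the edges of `m` known to lie in `P` already exhaust the bound on its load, all other edges
of `m` lie outside `P`. -/
theorem Agrees.of_le_pop {P : ℕ → Bool} {m n k b : ℕ} (hm : m < 2 ^ 384)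
    (h : ∀ e, n.testBit e = true → P e = true) (hb : load P m ≤ b)
    (hp : b ≤ pop k (Nat.land n m)) (e : ℕ) (he : e < 384) (hme : m.testBit e = true)
    (hne : ¬ n.testBit e = true) : P e = false := by
  have h1 := hp.trans (pop_le k _ (lt_of_le_of_lt (Nat.and_le_right (n := n)) hm))
  by_contra hP
  rw [Bool.not_eq_false] at hP
  have : ((Finset.range 384).filter fun e => (Nat.land n m).testBit e = true).card < load P m := by
    apply Finset.card_lt_card
    rw [Finset.ssubset_iff_of_subset]
    · refine ⟨e, ?_, ?_⟩
      · simp only [Finset.mem_filter, Finset.mem_range]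
        exact ⟨he, hme, hP⟩
      · simp only [Finset.mem_filter, testBit_land]
        tauto
    · intro e he
      simp only [Finset.mem_filter, testBit_land] at he ⊢
      exact ⟨he.1, he.2.2, h e he.2.1⟩
  omega

/-! ### Sets of edges of the six-dimensional cube and their symmetries -/

abbrev Vertex := Fin 6 → Bool

def flip (v : Vertex) (i : Fin 6) : Vertex := Function.update v i (!v i)

def ofCode (x : ℕ) : Vertex := fun i => x.testBit i

/-- A set of edges, `F v i` saying that the edge at `v` in direction `i` belongs to it, which meets
every four-cycle. -/
structure IsHitting (F : Vertex → Fin 6 → Bool) : Prop where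
  flip : ∀ v i, F (flip v i) i = F v i
  hit : ∀ v i j, i ≠ j →
    F v i = true ∨ F v j = true ∨ F (SquareFree.flip v i) j = true ∨
      F (SquareFree.flip v j) i = true

/-- The edge in direction `i` at the vertex with code `x` has code `64 * i + x`. -/
def code (F : Vertex → Fin 6 → Bool) (e : ℕ) : Bool := F (ofCode (e % 64)) (Fin.ofNat 6 (e / 64))

theorem code_mk (F : Vertex → Fin 6 → Bool) (i : Fin 6) {x : ℕ} (hx : x < 64) :
    code F (64 * i + x) = F (ofCode x) i := by
  unfold code
  have h1 : (64 * (i : ℕ) + x) % 64 = x := by omega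
  have h2 : (64 * (i : ℕ) + x) / 64 = i := by omega
  rw [h1, h2]
  congr
  ext
  simp

theorem ofCode_add : ∀ (i : Fin 6) (x : Fin 64), (x : ℕ).testBit i = false →
    ofCode (x + 2 ^ (i : ℕ)) = flip (ofCode x) i := by decide +kernel

theorem ofCode_bijective : Function.Bijective fun x : Fin 64 => ofCode x := by
  rw [Fintype.bijective_iff_injective_and_card]
  refine ⟨?_, by simp⟩
  intro x y
  revert x y
  decide +kernel

theorem flip_apply (v : Vertex) (i j : Fin 6) :
    flip v i j = if j = i then !v i else v j := by
  unfold flip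
  rw [Function.update_apply]

theorem flip_flip (v : Vertex) (i : Fin 6) : flip (flip v i) i = v := by
  ext j
  rw [flip_apply, flip_apply, flip_apply]
  split_ifs with h <;> simp_all

/-- The edge codes whose vertex part is the lower end of the edge. -/
def lowEdges : Finset ℕ := (Finset.range 384).filter fun e => (e % 64).testBit (e / 64) = false

/-- Each edge is counted once, through its lower end. The sum `weight` counts it from both ends, so
it can be reindexed along a symmetry without tracking which end is lower. -/
def cnt (F : Vertex → Fin 6 → Bool) (w : Vertex → Fin 6 → ℕ) : ℕ :=
  ∑ e ∈ lowEdges, if code F e = true then w (ofCode (e % 64)) (Fin.ofNat 6 (e / 64)) else 0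

def weight (F : Vertex → Fin 6 → Bool) (w : Vertex → Fin 6 → ℕ) : ℕ :=
  ∑ v, ∑ i, if F v i = true then w v i else 0

theorem sum_eq_two_mul {i : Fin 6} {g : Vertex → ℕ} (hg : ∀ v, g (flip v i) = g v) :
    ∑ v, g v = 2 * ∑ v, if v i = false then g v else 0 := by
  have h1 : ∑ v, g v = (∑ v, if v i = false then g v else 0) +
      ∑ v, if v i = true then g v else 0 := by
    rw [← Finset.sum_add_distrib]
    refine Finset.sum_congr rfl fun v _ => ?_
    cases v i <;> simp
  have h2 : (∑ v, if v i = true then g v else 0) = ∑ v, if v i = false then g v else 0 := by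
    let φ : Vertex ≃ Vertex := ⟨fun v => flip v i, fun v => flip v i,
      fun v => flip_flip v i, fun v => flip_flip v i⟩
    rw [← Equiv.sum_comp φ]
    refine Finset.sum_congr rfl fun v _ => ?_
    change (if flip v i i = true then g (flip v i) else 0) = _
    rw [hg, flip_apply]
    simp
  omega

theorem sum_lowEdges (g : Vertex → Fin 6 → ℕ) :
    ∑ e ∈ lowEdges, g (ofCode (e % 64)) (Fin.ofNat 6 (e / 64)) =
      ∑ i, ∑ v, if v i = false then g v i else 0 := by
  unfold lowEdges
  rw [Finset.sum_filter, Finset.sum_range, ← Equiv.sum_comp (finProdFinEquiv (m := 6) (n := 64)),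
    Fintype.sum_prod_type]
  refine Finset.sum_congr rfl fun i _ => ?_
  rw [← Function.Bijective.sum_comp ofCode_bijective]
  refine Finset.sum_congr rfl fun x _ => ?_
  have h1 : ((finProdFinEquiv (i, x) : Fin (6 * 64)) : ℕ) = x + 64 * i := rfl
  have h2 : ((x : ℕ) + 64 * i) % 64 = x := by omega
  have h3 : ((x : ℕ) + 64 * i) / 64 = i := by omega
  have h4 : Fin.ofNat 6 (i : ℕ) = i := by
    ext
    simp
  rw [h1, h2, h3, h4]
  rfl

theorem weight_eq {F : Vertex → Fin 6 → Bool} (hF : IsHitting F) {w : Vertex → Fin 6 → ℕ}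
    (hw : ∀ v i, w (flip v i) i = w v i) : weight F w = 2 * cnt F w := by
  unfold weight cnt
  have := sum_lowEdges fun v i => if F v i = true then w v i else 0
  refine Eq.trans ?_ (congrArg (2 * ·) this.symm)
  rw [Finset.sum_comm]
  rw [Finset.mul_sum]
  refine Finset.sum_congr rfl fun i _ => ?_
  refine sum_eq_two_mul fun v => ?_
  rw [hF.flip, hw]

/-! ### Reflections and permutations of the coordinates. -/

def refl (F : Vertex → Fin 6 → Bool) (t : Vertex) : Vertex → Fin 6 → Bool :=
  fun v i => F (fun k => v k ^^ t k) i

/-- The direction becomes `σ.symm i` because flipping coordinate `i` of `v` flips coordinate `σ.symm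
i` of `v ∘ σ`. -/
def perm (F : Vertex → Fin 6 → Bool) (σ : Equiv.Perm (Fin 6)) : Vertex → Fin 6 → Bool :=
  fun v i => F (v ∘ σ) (σ.symm i)

theorem flip_xor (v t : Vertex) (i : Fin 6) :
    (fun k => flip v i k ^^ t k) = flip (fun k => v k ^^ t k) i := by
  ext k
  rw [flip_apply, flip_apply]
  split_ifs with h <;> simp_all

theorem flip_comp (v : Vertex) (σ : Equiv.Perm (Fin 6)) (i : Fin 6) :
    flip v i ∘ σ = flip (v ∘ σ) (σ.symm i) := by
  ext k
  simp only [Function.comp_apply, flip_apply, Equiv.apply_symm_apply, Equiv.eq_symm_apply]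

theorem IsHitting.refl {F : Vertex → Fin 6 → Bool} (hF : IsHitting F) (t : Vertex) :
    IsHitting (refl F t) := by
  refine ⟨fun v i => ?_, fun v i j hij => ?_⟩
  · simp only [SquareFree.refl, flip_xor, hF.flip]
  · simp only [SquareFree.refl, flip_xor]
    exact hF.hit _ i j hij

theorem IsHitting.perm {F : Vertex → Fin 6 → Bool} (hF : IsHitting F) (σ : Equiv.Perm (Fin 6)) :
    IsHitting (perm F σ) := by
  refine ⟨fun v i => ?_, fun v i j hij => ?_⟩
  · simp only [SquareFree.perm, flip_comp, hF.flip]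
  · simp only [SquareFree.perm, flip_comp]
    exact hF.hit _ _ _ fun h => hij (σ.symm.injective h)

theorem cnt_refl {F : Vertex → Fin 6 → Bool} (hF : IsHitting F) (t : Vertex)
    {w w' : Vertex → Fin 6 → ℕ} (hw : ∀ v i, w (flip v i) i = w v i)
    (hw' : ∀ v i, w' v i = w (fun k => v k ^^ t k) i) : cnt (refl F t) w = cnt F w' := by
  have h1 := weight_eq (hF.refl t) hw
  have h2 : weight F w' = 2 * cnt F w' := weight_eq hF fun v i => by
    rw [hw', hw', flip_xor, hw]
  have h3 : weight (refl F t) w = weight F w' := by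
    unfold weight
    let φ : Vertex ≃ Vertex := ⟨fun v k => v k ^^ t k, fun v k => v k ^^ t k,
      fun v => by ext; simp, fun v => by ext; simp⟩
    rw [← Equiv.sum_comp φ]
    refine Finset.sum_congr rfl fun v _ => Finset.sum_congr rfl fun i _ => ?_
    rw [hw' v i]
    simp [refl, φ]
  omega

theorem cnt_perm {F : Vertex → Fin 6 → Bool} (hF : IsHitting F) (σ : Equiv.Perm (Fin 6))
    {w w' : Vertex → Fin 6 → ℕ} (hw : ∀ v i, w (flip v i) i = w v i)
    (hw' : ∀ v i, w' v i = w (v ∘ σ.symm) (σ i)) : cnt (perm F σ) w = cnt F w' := by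
  have h1 := weight_eq (hF.perm σ) hw
  have h2 : weight F w' = 2 * cnt F w' := weight_eq hF fun v i => by
    rw [hw', hw', flip_comp, Equiv.symm_symm, hw]
  have h3 : weight (perm F σ) w = weight F w' := by
    unfold weight
    let φ : Vertex ≃ Vertex := Equiv.arrowCongr σ (Equiv.refl Bool)
    rw [← Equiv.sum_comp φ]
    refine Finset.sum_congr rfl fun v _ => ?_
    rw [← Equiv.sum_comp σ]
    refine Finset.sum_congr rfl fun i _ => ?_
    rw [hw' v i]
    have : (φ v) ∘ σ = v := by
      ext k
      simp [φ]
    simp only [perm, this, Equiv.symm_apply_apply]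
    rfl
  omega

/-! ### Subcubes -/

/-- The edges of the subcube `v j = b`. -/
def w5 (j : Fin 6) (b : Bool) : Vertex → Fin 6 → ℕ := fun v i => if v j = b ∧ i ≠ j then 1 else 0

/-- The edges of the subcube `v j = b`, `v e = c`. -/
def w4 (j : Fin 6) (b : Bool) (e : Fin 6) (c : Bool) : Vertex → Fin 6 → ℕ :=
  fun v i => if v j = b ∧ v e = c ∧ i ≠ j ∧ i ≠ e then 1 else 0

/-- The edges in direction `d` of the subcube `v j = b`. -/
def wd5 (j : Fin 6) (b : Bool) (d : Fin 6) : Vertex → Fin 6 → ℕ :=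
  fun v i => if v j = b ∧ i = d ∧ i ≠ j then 1 else 0

def wd (d : Fin 6) : Vertex → Fin 6 → ℕ := fun _ i => if i = d then 1 else 0

def w6 : Vertex → Fin 6 → ℕ := fun _ _ => 1

theorem w5_flip (j : Fin 6) (b : Bool) (v : Vertex) (i : Fin 6) :
    w5 j b (flip v i) i = w5 j b v i := by
  unfold w5
  rw [flip_apply]
  by_cases h : i = j
  · simp [h]
  · simp [h, Ne.symm h]

theorem w4_flip (j : Fin 6) (b : Bool) (e : Fin 6) (c : Bool) (v : Vertex) (i : Fin 6) :
    w4 j b e c (flip v i) i = w4 j b e c v i := by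
  unfold w4
  rw [flip_apply, flip_apply]
  by_cases h : i = j
  · simp [h]
  · by_cases h' : i = e
    · simp [h']
    · simp [h, h', Ne.symm h, Ne.symm h']

theorem wd5_flip (j : Fin 6) (b : Bool) (d : Fin 6) (v : Vertex) (i : Fin 6) :
    wd5 j b d (flip v i) i = wd5 j b d v i := by
  unfold wd5
  rw [flip_apply]
  by_cases h : i = j
  · simp [h]
  · simp [h, Ne.symm h]

theorem xor_eq_iff (a b c : Bool) : (a ^^ b) = c ↔ a = (c ^^ b) := by
  cases a <;> cases b <;> cases c <;> simp

section transport

variable {F : Vertex → Fin 6 → Bool} (hF : IsHitting F)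
include hF

theorem cnt_refl_w5 (t : Vertex) (j : Fin 6) (b : Bool) :
    cnt (refl F t) (w5 j b) = cnt F (w5 j (b ^^ t j)) :=
  cnt_refl hF t (w5_flip j b) fun v i => by simp only [w5, xor_eq_iff]

theorem cnt_refl_w4 (t : Vertex) (j : Fin 6) (b : Bool) (e : Fin 6) (c : Bool) :
    cnt (refl F t) (w4 j b e c) = cnt F (w4 j (b ^^ t j) e (c ^^ t e)) :=
  cnt_refl hF t (w4_flip j b e c) fun v i => by simp only [w4, xor_eq_iff]

theorem cnt_refl_wd5 (t : Vertex) (j : Fin 6) (b : Bool) (d : Fin 6) :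
    cnt (refl F t) (wd5 j b d) = cnt F (wd5 j (b ^^ t j) d) :=
  cnt_refl hF t (wd5_flip j b d) fun v i => by simp only [wd5, xor_eq_iff]

theorem cnt_refl_wd (t : Vertex) (d : Fin 6) : cnt (refl F t) (wd d) = cnt F (wd d) :=
  cnt_refl hF t (fun _ _ => rfl) fun _ _ => rfl

theorem cnt_refl_w6 (t : Vertex) : cnt (refl F t) w6 = cnt F w6 :=
  cnt_refl hF t (fun _ _ => rfl) fun _ _ => rfl

theorem cnt_perm_w5 (σ : Equiv.Perm (Fin 6)) (j : Fin 6) (b : Bool) :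
    cnt (perm F σ) (w5 j b) = cnt F (w5 (σ.symm j) b) :=
  cnt_perm hF σ (w5_flip j b) fun v i => by
    simp only [w5, Function.comp_apply, ne_eq, Equiv.eq_symm_apply]

theorem cnt_perm_w4 (σ : Equiv.Perm (Fin 6)) (j : Fin 6) (b : Bool) (e : Fin 6) (c : Bool) :
    cnt (perm F σ) (w4 j b e c) = cnt F (w4 (σ.symm j) b (σ.symm e) c) :=
  cnt_perm hF σ (w4_flip j b e c) fun v i => by
    simp only [w4, Function.comp_apply, ne_eq, Equiv.eq_symm_apply]

theorem cnt_perm_wd5 (σ : Equiv.Perm (Fin 6)) (j : Fin 6) (b : Bool) (d : Fin 6) :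
    cnt (perm F σ) (wd5 j b d) = cnt F (wd5 (σ.symm j) b (σ.symm d)) :=
  cnt_perm hF σ (wd5_flip j b d) fun v i => by
    simp only [wd5, Function.comp_apply, ne_eq, Equiv.eq_symm_apply]

theorem cnt_perm_wd (σ : Equiv.Perm (Fin 6)) (d : Fin 6) :
    cnt (perm F σ) (wd d) = cnt F (wd (σ.symm d)) :=
  cnt_perm hF σ (fun _ _ => rfl) fun v i => by
    simp only [wd, Equiv.eq_symm_apply]

theorem cnt_perm_w6 (σ : Equiv.Perm (Fin 6)) : cnt (perm F σ) w6 = cnt F w6 :=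
  cnt_perm hF σ (fun _ _ => rfl) fun _ _ => rfl

end transport

/-! ### Counting identities -/

theorem cnt_add (F : Vertex → Fin 6 → Bool) (w w' : Vertex → Fin 6 → ℕ) :
    cnt F (w + w') = cnt F w + cnt F w' := by
  unfold cnt
  rw [← Finset.sum_add_distrib]
  refine Finset.sum_congr rfl fun e _ => ?_
  split_ifs <;> rfl

theorem cnt_sum {ι : Type*} (s : Finset ι) (F : Vertex → Fin 6 → Bool)
    (w : ι → Vertex → Fin 6 → ℕ) : cnt F (∑ k ∈ s, w k) = ∑ k ∈ s, cnt F (w k) := by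
  classical
  induction s using Finset.induction_on with
  | empty =>
    unfold cnt
    simp
  | insert a s ha ih => rw [Finset.sum_insert ha, Finset.sum_insert ha, cnt_add, ih]

theorem cnt_w6_eq (F : Vertex → Fin 6 → Bool) (j : Fin 6) :
    cnt F w6 = cnt F (w5 j false) + cnt F (w5 j true) + cnt F (wd j) := by
  rw [← cnt_add, ← cnt_add]
  congr 1
  ext v i
  simp only [w6, w5, wd, Pi.add_apply]
  cases v j <;> by_cases h : i = j <;> simp [h]

theorem cnt_w6_eq_sum (F : Vertex → Fin 6 → Bool) : cnt F w6 = ∑ d, cnt F (wd d) := by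
  rw [← cnt_sum]
  congr 1
  ext v i
  simp [w6, wd, Finset.sum_apply]

theorem cnt_wd_eq (F : Vertex → Fin 6 → Bool) {j d : Fin 6} (h : d ≠ j) :
    cnt F (wd d) = cnt F (wd5 j false d) + cnt F (wd5 j true d) := by
  rw [← cnt_add]
  congr 1
  ext v i
  simp only [wd, wd5, Pi.add_apply]
  cases v j <;> by_cases h' : i = d <;> simp [h', h]

theorem cnt_w5_eq (F : Vertex → Fin 6 → Bool) {j e : Fin 6} (h : e ≠ j) (b : Bool) :
    cnt F (w5 j b) = cnt F (w4 j b e false) + cnt F (w4 j b e true) + cnt F (wd5 j b e) := by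
  rw [← cnt_add, ← cnt_add]
  congr 1
  ext v i
  simp only [w5, w4, wd5, Pi.add_apply]
  by_cases h1 : v j = b <;> cases h2 : v e <;> by_cases h3 : i = e <;> by_cases h4 : i = j <;>
    simp_all

theorem cnt_w5_eq_sum (F : Vertex → Fin 6 → Bool) (j : Fin 6) (b : Bool) :
    cnt F (w5 j b) = ∑ d ∈ Finset.univ.erase j, cnt F (wd5 j b d) := by
  rw [← cnt_sum]
  congr 1
  ext v i
  simp only [w5, wd5, Finset.sum_apply]
  by_cases h1 : v j = b <;> by_cases h4 : i = j <;> simp [h1, h4]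

/-- For each of the four directions `e` other than `j` and its own, an edge of the subcube lies in
exactly one of the two faces in direction `e`. -/
theorem sum_faces (F : Vertex → Fin 6 → Bool) (j : Fin 6) (b : Bool) :
    ∑ e ∈ Finset.univ.erase j, (cnt F (w4 j b e false) + cnt F (w4 j b e true)) =
      4 * cnt F (w5 j b) := by
  have h1 : ∑ e ∈ Finset.univ.erase j, (cnt F (w4 j b e false) + cnt F (w4 j b e true)) +
      cnt F (w5 j b) = ∑ e ∈ Finset.univ.erase j, cnt F (w5 j b) := by
    rw [cnt_w5_eq_sum, ← Finset.sum_add_distrib, ← cnt_w5_eq_sum]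
    refine Finset.sum_congr rfl fun e he => ?_
    rw [← cnt_w5_eq F (Finset.ne_of_mem_erase he) b]
  rw [Finset.sum_const, Finset.card_erase_of_mem (Finset.mem_univ _), Finset.card_univ,
    Fintype.card_fin, smul_eq_mul] at h1
  omega

/-- The squares in directions `i` and `d` of the subcube are eight edge-disjoint squares, each of
them hit. Summing over the 32 vertices counts every square from its four corners, whence `8 = 32 /
4`. -/
theorem eight_le_cnt_add {F : Vertex → Fin 6 → Bool} (hF : IsHitting F) {j d i : Fin 6}
    (hd : d ≠ j) (hi : i ≠ j) (hid : i ≠ d) (b : Bool) :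
    8 ≤ cnt F (wd5 j b i) + cnt F (wd5 j b d) := by
  let u : Vertex → Fin 6 → ℕ := fun v i => if F v i = true then 1 else 0
  have hw : ∀ k, k ≠ j → ∑ v, (if v j = b then u v k else 0) = 2 * cnt F (wd5 j b k) := by
    intro k hk
    rw [← weight_eq hF (wd5_flip j b k)]
    unfold weight
    refine Finset.sum_congr rfl fun v _ => ?_
    rw [Finset.sum_eq_single k]
    · simp only [wd5, u, hk, ne_eq, not_false_eq_true, and_true]
      split_ifs <;> rfl
    · intro i _ hik
      simp [wd5, hik]
    · simp
  have hflip : ∀ k l, l ≠ j → ∑ v, (if v j = b then u (flip v l) k else 0) =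
      ∑ v, (if v j = b then u v k else 0) := by
    intro k l hl
    let φ : Vertex ≃ Vertex := ⟨fun v => flip v l, fun v => flip v l,
      fun v => flip_flip v l, fun v => flip_flip v l⟩
    rw [← Equiv.sum_comp φ]
    refine Finset.sum_congr rfl fun v _ => ?_
    change (if flip v l j = b then u (flip (flip v l) l) k else 0) = _
    rw [flip_flip, flip_apply, if_neg (Ne.symm hl)]
  have hcard : ∀ (j : Fin 6) (b : Bool), ∑ v : Vertex, (if v j = b then 1 else 0) = 32 := by
    decide +kernel
  have hle : ∑ v : Vertex, (if v j = b then 1 else 0) ≤ ∑ v : Vertex,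
      ((if v j = b then u v i else 0) + (if v j = b then u v d else 0) +
        (if v j = b then u (flip v i) d else 0) + (if v j = b then u (flip v d) i else 0)) := by
    refine Finset.sum_le_sum fun v _ => ?_
    split_ifs
    · have := hF.hit v i d hid
      simp only [u]
      split_ifs <;> simp_all
    · simp
  rw [Finset.sum_add_distrib, Finset.sum_add_distrib, Finset.sum_add_distrib, hcard j b,
    hflip d i hi, hflip i d hd, hw i hi, hw d hd] at hle
  omega

/-- The squares through direction `d` in a five-dimensional subcube. -/
theorem le_cnt_w5_add {F : Vertex → Fin 6 → Bool} (hF : IsHitting F) {j d : Fin 6} (hd : d ≠ j)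
    (b : Bool) : 32 ≤ cnt F (w5 j b) + 3 * cnt F (wd5 j b d) := by
  have hmem : d ∈ Finset.univ.erase j := Finset.mem_erase.2 ⟨hd, Finset.mem_univ _⟩
  have h1 : ∑ _i ∈ (Finset.univ.erase j).erase d, 8 ≤
      ∑ i ∈ (Finset.univ.erase j).erase d, (cnt F (wd5 j b i) + cnt F (wd5 j b d)) := by
    refine Finset.sum_le_sum fun i hi => ?_
    rw [Finset.mem_erase, Finset.mem_erase] at hi
    exact eight_le_cnt_add hF hd hi.2.1 hi.1 b
  have hc : ((Finset.univ.erase j).erase d).card = 4 := by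
    rw [Finset.card_erase_of_mem hmem, Finset.card_erase_of_mem (Finset.mem_univ _)]
    rfl
  rw [Finset.sum_add_distrib, Finset.sum_const, Finset.sum_const, hc] at h1
  rw [cnt_w5_eq_sum, ← Finset.add_sum_erase _ _ hmem]
  simp only [smul_eq_mul] at h1
  omega

/-! ### Masks of edges, squares and faces -/

def edgeBit (i x : ℕ) : ℕ := Nat.pow 2 (Nat.add (Nat.mul 64 i) x)

def bitAt (x i : ℕ) : ℕ := Nat.land (Nat.shiftRight x i) 1

def bits (l : List ℕ) : ℕ := l.foldr Nat.lor 0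

/-- Clears the binary digit `i`. -/
def clr (i x : ℕ) : ℕ := Nat.sub x (Nat.land x (Nat.pow 2 i))

/-- Meant for `x` with digits `i` and `j` zero, as selected in `squares`; all four edges are then
named by their lower ends. -/
def mkSquare (i j x : ℕ) : Square :=
  let a := edgeBit i x
  let b := edgeBit j x
  let c := edgeBit i (Nat.add x (Nat.pow 2 j))
  let d := edgeBit j (Nat.add x (Nat.pow 2 i))
  ⟨Nat.lor a (Nat.lor b (Nat.lor c d)), a, b, c, d⟩

def dirPairs : List (ℕ × ℕ) :=
  [(0, 1), (0, 2), (0, 3), (0, 4), (0, 5), (1, 2), (1, 3), (1, 4), (1, 5), (2, 3), (2, 4), (2, 5),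
    (3, 4), (3, 5), (4, 5)]

def squares (p : ℕ → ℕ → ℕ → Bool) : List Square :=
  dirPairs.flatMap fun ij => ((List.range 64).filter fun x =>
    Nat.beq (bitAt x ij.1) 0 && (Nat.beq (bitAt x ij.2) 0 && p ij.1 ij.2 x)).map
      (mkSquare ij.1 ij.2)

/-! ### Four-dimensional faces and perfect patterns. -/

def swapIdx (a b i : ℕ) : ℕ := bif Nat.beq i a then b else bif Nat.beq i b then a else i

def swapBits (a b x : ℕ) : ℕ :=
  bif Nat.beq (bitAt x a) (bitAt x b) then x else Nat.xor x (Nat.xor (Nat.pow 2 a) (Nat.pow 2 b))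

/-- The four-dimensional subcube `v j = b`, `v e = c`. -/
structure Face where
  j : ℕ
  b : ℕ
  e : ℕ
  c : ℕ

/-- A permutation of the directions taking 0 to `f.j` and 1 to `f.e`; the inner swap aims at the
index that the outer one sends to `f.e`. -/
def Face.dir (f : Face) (i : ℕ) : ℕ := swapIdx 0 f.j (swapIdx 1 (swapIdx 0 f.j f.e) i)

def Face.vert (f : Face) (x : ℕ) : ℕ := swapBits 0 f.j (swapBits 1 (swapIdx 0 f.j f.e) x)

def Face.off (f : Face) : ℕ :=
  Nat.add (Nat.mul f.b (Nat.pow 2 f.j)) (Nat.mul f.c (Nat.pow 2 f.e))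

/-- The image in the face `f` of an edge of the face `v 0 = v 1 = 0`. -/
def Face.edge (f : Face) (p : ℕ × ℕ) : ℕ × ℕ :=
  (f.dir p.1, clr (f.dir p.1) (Nat.xor (f.vert p.2) f.off))

def Face.image (f : Face) (l : List (ℕ × ℕ)) : ℕ :=
  bits (l.map fun p => edgeBit (f.edge p).1 (f.edge p).2)

def faceEdges : List (ℕ × ℕ) :=
  [2, 3, 4, 5].flatMap fun i => ((List.range 16).filter fun x =>
    Nat.beq (bitAt x (Nat.sub i 2)) 0).map fun x => (i, Nat.mul 4 x)

def Face.all (f : Face) : ℕ := f.image faceEdges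

/-- Eight edges of the face `v 0 = v 1 = 0` meeting each of its squares exactly once. -/
def perfect : List (ℕ × ℕ) :=
  [(2, 0), (2, 56), (3, 20), (3, 32), (4, 8), (4, 36), (5, 12), (5, 16)]

def pattern (s : ℕ) : List (ℕ × ℕ) := perfect.map fun p => (p.1, clr p.1 (Nat.xor p.2 s))

/-- The set `perfect` is invariant under the antipodal map of its face, the shift by 60. Hence these
eight shifts, which leave coordinate 2 alone, produce all its translates. -/
def shifts : List ℕ := [0, 8, 16, 24, 32, 40, 48, 56]

/-- The included and excluded edges for each of the eight perfect patterns on a face. -/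
def Face.seeds (f : Face) : List (ℕ × ℕ) :=
  let a := f.all
  shifts.map fun s =>
    let m := f.image (pattern s)
    (m, Nat.xor a m)

def edges : List (ℕ × ℕ) :=
  [0, 1, 2, 3, 4, 5].flatMap fun i => ((List.range 64).filter fun x =>
    Nat.beq (bitAt x i) 0).map fun x => (i, x)

def edgesMask (p : ℕ → ℕ → Bool) : ℕ :=
  bits ((edges.filter fun e => p e.1 e.2).map fun e => edgeBit e.1 e.2)

def q5Mask (j b : ℕ) : ℕ := edgesMask fun i x => !(Nat.beq i j) && Nat.beq (bitAt x j) b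

def q5Squares (j b : ℕ) : List Square :=
  squares fun i k x => !(Nat.beq i j) && (!(Nat.beq k j) && Nat.beq (bitAt x j) b)

def q6Mask : ℕ := edgesMask fun _ _ => true

def q6Squares : List Square := squares fun _ _ _ => true

def dirMask (d : ℕ) : ℕ := edgesMask fun i x => Nat.beq i d && Nat.beq (bitAt x 0) 0

def baseFace : Face := ⟨0, 0, 1, 0⟩

def baseSquares : List Square := squares fun i _ x => Nat.ble 2 i && Nat.beq (Nat.land x 3) 0

/-! ### Masks compared with edge sets and edge counts. -/

theorem testBit_edgeBit (i x e : ℕ) : (edgeBit i x).testBit e = true ↔ 64 * i + x = e :=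
  testBit_pow _ _

theorem testBit_bits (l : List ℕ) (e : ℕ) :
    (bits l).testBit e = true ↔ ∃ m ∈ l, m.testBit e = true := by
  induction l with
  | nil => simp [bits]
  | cons m l ih =>
    change (Nat.lor m (bits l)).testBit e = true ↔ _
    rw [testBit_lor, ih]
    simp

theorem testBit_of_bitAt {x i : ℕ} (h : Nat.beq (bitAt x i) 0 = true) : x.testBit i = false := by
  have h' : (x >>> i) &&& 1 = 0 := Nat.eq_of_beq_eq_true h
  rw [Nat.testBit, Nat.and_comm, h']
  rfl

theorem dirPairs_lt : ∀ ij ∈ dirPairs, ij.1 < ij.2 ∧ ij.2 < 6 := by decide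

theorem exists_of_mem_squares {p : ℕ → ℕ → ℕ → Bool} {c : Square} (hc : c ∈ squares p) :
    ∃ i j : Fin 6, ∃ x : ℕ, x < 64 ∧ i ≠ j ∧ x.testBit i = false ∧ x.testBit j = false ∧
      c = mkSquare i j x := by
  simp only [squares, List.mem_flatMap, List.mem_map, List.mem_filter, List.mem_range,
    Bool.and_eq_true] at hc
  obtain ⟨ij, hij, x, ⟨hx, h1, h2, -⟩, rfl⟩ := hc
  obtain ⟨h3, h4⟩ := dirPairs_lt ij hij
  refine ⟨⟨ij.1, by omega⟩, ⟨ij.2, h4⟩, x, hx, ?_, testBit_of_bitAt h1, testBit_of_bitAt h2, rfl⟩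
  intro h
  rw [Fin.mk.injEq] at h
  omega

theorem add_lt_of_testBit : ∀ (i : Fin 6) (x : Fin 64), (x : ℕ).testBit i = false →
    (x : ℕ) + 2 ^ (i : ℕ) < 64 := by decide +kernel

theorem covered_of_mem_squares {F : Vertex → Fin 6 → Bool} (hF : IsHitting F) {m : ℕ}
    {p : ℕ → ℕ → ℕ → Bool}
    (hm : ((squares p).all fun c => Nat.beq (Nat.land m c.mask) c.mask) = true) :
    ∀ c ∈ squares p, Covered (code F) m c := by
  intro c hc
  have hcm := Nat.eq_of_beq_eq_true (List.all_eq_true.1 hm c hc)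
  obtain ⟨i, j, x, hx, hij, hi, hj, rfl⟩ := exists_of_mem_squares hc
  have hi' := add_lt_of_testBit i ⟨x, hx⟩ hi
  have hj' := add_lt_of_testBit j ⟨x, hx⟩ hj
  simp only at hi' hj'
  have hmask : ∀ e, (mkSquare i j x).mask.testBit e = true → m.testBit e = true := by
    intro e he
    rw [← hcm, testBit_land] at he
    exact he.1
  have hmask' : ∀ a ∈ [64 * (i : ℕ) + x, 64 * (j : ℕ) + x, 64 * (i : ℕ) + (x + 2 ^ (j : ℕ)),
      64 * (j : ℕ) + (x + 2 ^ (i : ℕ))], (mkSquare i j x).mask.testBit a = true := by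
    intro a ha
    simp only [List.mem_cons, List.not_mem_nil, or_false] at ha
    simp only [mkSquare, testBit_lor, testBit_edgeBit]
    rcases ha with rfl | rfl | rfl | rfl
    · exact Or.inl rfl
    · exact Or.inr (Or.inl rfl)
    · exact Or.inr (Or.inr (Or.inl rfl))
    · exact Or.inr (Or.inr (Or.inr rfl))
  refine ⟨64 * i + x, 64 * j + x, 64 * i + (x + 2 ^ (j : ℕ)), 64 * j + (x + 2 ^ (i : ℕ)),
    rfl, rfl, rfl, rfl, fun a ha => ⟨hmask' a ha, hmask _ (hmask' a ha), ?_⟩, ?_⟩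
  · simp only [List.mem_cons, List.not_mem_nil, or_false] at ha
    omega
  · rw [code_mk F i hx, code_mk F j hx, code_mk F i hj', code_mk F j hi',
      ofCode_add i ⟨x, hx⟩ hi, ofCode_add j ⟨x, hx⟩ hj]
    have := hF.hit (ofCode x) i j hij
    tauto

theorem load_eq_cnt (F : Vertex → Fin 6 → Bool) {m : ℕ} {w : Vertex → Fin 6 → ℕ}
    (h : ∀ e : Fin 384, m.testBit e = decide (((e : ℕ) % 64).testBit (e / 64) = false ∧
      w (ofCode (e % 64)) (Fin.ofNat 6 (e / 64)) = 1)) (hw : ∀ v i, w v i = 0 ∨ w v i = 1) :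
    load (code F) m = cnt F w := by
  unfold load cnt lowEdges
  rw [Finset.card_filter, Finset.sum_filter]
  refine Finset.sum_congr rfl fun e he => ?_
  have := h ⟨e, Finset.mem_range.1 he⟩
  simp only at this
  rw [this]
  rcases hw (ofCode (e % 64)) (Fin.ofNat 6 (e / 64)) with h0 | h0 <;> rw [h0] <;>
    split_ifs <;> simp_all

theorem load_q5Mask (F : Vertex → Fin 6 → Bool) (j : Fin 6) (b : Bool) :
    load (code F) (q5Mask j b.toNat) = cnt F (w5 j b) := by
  refine load_eq_cnt F ?_ fun v i => by unfold w5; split_ifs <;> simp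
  revert j b
  decide +kernel

theorem load_q6Mask (F : Vertex → Fin 6 → Bool) : load (code F) q6Mask = cnt F w6 :=
  load_eq_cnt F (by decide +kernel) fun v i => Or.inr rfl

theorem load_all_baseFace (F : Vertex → Fin 6 → Bool) :
    load (code F) baseFace.all = cnt F (w4 0 false 1 false) :=
  load_eq_cnt F (by decide +kernel) fun v i => by unfold w4; split_ifs <;> simp

theorem load_all_face (F : Vertex → Fin 6 → Bool) :
    load (code F) (Face.all ⟨0, 0, 2, 0⟩) = cnt F (w4 0 false 2 false) :=
  load_eq_cnt F (by decide +kernel) fun v i => by unfold w4; split_ifs <;> simp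

theorem q5Mask_lt : ∀ (j : Fin 6) (b : Bool), q5Mask j b.toNat < 2 ^ 384 := by decide +kernel

theorem q5Squares_mask : ∀ (j : Fin 6) (b : Bool), ((q5Squares j b.toNat).all fun c =>
    Nat.beq (Nat.land (q5Mask j b.toNat) c.mask) c.mask) = true := by decide +kernel

theorem q6Squares_mask : (q6Squares.all fun c =>
    Nat.beq (Nat.land q6Mask c.mask) c.mask) = true := by decide +kernel

theorem baseSquares_mask : (baseSquares.all fun c =>
    Nat.beq (Nat.land baseFace.all c.mask) c.mask) = true := by decide +kernel

/-! ### Moving a face to the base face -/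

theorem swapIdx_eq : ∀ a b i : Fin 6, swapIdx a b i = (Equiv.swap a b i : Fin 6) := by
  decide +kernel

theorem ofCode_swapBits : ∀ (a b : Fin 6) (x : Fin 64), swapBits a b x < 64 ∧
    ofCode (swapBits a b x) = ofCode x ∘ Equiv.swap a b := by decide +kernel

theorem clr_eq : ∀ (i : Fin 6) (x : Fin 64), clr i x < 64 ∧
    (ofCode (clr i x) = ofCode x ∨ ofCode (clr i x) = flip (ofCode x) i) := by decide +kernel

theorem ofCode_xor (x y : ℕ) : ofCode (Nat.xor x y) = fun k => ofCode x k ^^ ofCode y k := by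
  ext k
  exact Nat.testBit_xor x y k

theorem code_clr {F : Vertex → Fin 6 → Bool} (hF : IsHitting F) (i : Fin 6) {x : ℕ} (hx : x < 64) :
    code F (64 * i + clr i x) = F (ofCode x) i := by
  obtain ⟨h1, h2⟩ := clr_eq i ⟨x, hx⟩
  rw [code_mk F i h1]
  rcases h2 with h2 | h2 <;> rw [h2]
  exact hF.flip _ _

def mkFace (j : Fin 6) (b : Bool) (e : Fin 6) (c : Bool) : Face := ⟨j, b.toNat, e, c.toNat⟩

/-- Moves the face `v j = b`, `v e = c` to `v 0 = v 1 = 0`. -/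
def onFace (F : Vertex → Fin 6 → Bool) (j : Fin 6) (b : Bool) (e : Fin 6) (c : Bool) :
    Vertex → Fin 6 → Bool :=
  perm (perm (refl F (ofCode (mkFace j b e c).off)) (Equiv.swap 0 j))
    (Equiv.swap 1 (Equiv.swap 0 j e))

theorem IsHitting.onFace {F : Vertex → Fin 6 → Bool} (hF : IsHitting F) (j : Fin 6) (b : Bool)
    (e : Fin 6) (c : Bool) : IsHitting (onFace F j b e c) :=
  ((hF.refl _).perm _).perm _

theorem off_spec : ∀ (j : Fin 6) (b : Bool) (e : Fin 6) (c : Bool), e ≠ j →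
    (mkFace j b e c).off < 64 ∧ ofCode (mkFace j b e c).off j = b ∧
      ofCode (mkFace j b e c).off e = c ∧ Equiv.swap 0 j e ≠ 0 := by decide +kernel

theorem cnt_onFace_w4 {F : Vertex → Fin 6 → Bool} (hF : IsHitting F) {j e : Fin 6} (h : e ≠ j)
    (b c : Bool) : cnt (onFace F j b e c) (w4 0 false 1 false) = cnt F (w4 j b e c) := by
  obtain ⟨-, h1, h2, h3⟩ := off_spec j b e c h
  unfold onFace
  rw [cnt_perm_w4 ((hF.refl _).perm _), cnt_perm_w4 (hF.refl _), cnt_refl_w4 hF]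
  simp only [Equiv.symm_swap, Equiv.swap_apply_left, Equiv.swap_apply_self,
    Equiv.swap_apply_of_ne_of_ne (a := (1 : Fin 6)) (x := 0) (by decide) (Ne.symm h3), h1, h2,
    Bool.false_xor]

/-- On edge codes `Face.edge` does what `onFace` does on edge sets; passing to the lower end is
harmless because a hitting set does not depend on the end chosen. -/
theorem code_edge {F : Vertex → Fin 6 → Bool} (hF : IsHitting F) {j e : Fin 6} (h : e ≠ j)
    (b c : Bool) {p : ℕ × ℕ} (h1 : p.1 < 6) (h2 : p.2 < 64) :
    code F (64 * ((mkFace j b e c).edge p).1 + ((mkFace j b e c).edge p).2) =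
      code (onFace F j b e c) (64 * p.1 + p.2) := by
  obtain ⟨i, x⟩ := p
  simp only at h1 h2
  obtain ⟨ho, -⟩ := off_spec j b e c h
  have hdir : (mkFace j b e c).dir i = ((Equiv.swap 0 j
      (Equiv.swap 1 (Equiv.swap 0 j e) ⟨i, h1⟩) : Fin 6) : ℕ) := by
    rw [← swapIdx_eq, ← swapIdx_eq, ← swapIdx_eq]
    rfl
  obtain ⟨v1, v2⟩ := ofCode_swapBits 1 (Equiv.swap 0 j e) ⟨x, h2⟩
  obtain ⟨v3, v4⟩ := ofCode_swapBits 0 j ⟨_, v1⟩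
  have hv : (mkFace j b e c).vert x =
      swapBits (0 : Fin 6) j (swapBits (1 : Fin 6) (Equiv.swap 0 j e : Fin 6) x) := by
    rw [← swapIdx_eq]
    rfl
  change code F (64 * (mkFace j b e c).dir i + clr ((mkFace j b e c).dir i)
    (Nat.xor ((mkFace j b e c).vert x) (mkFace j b e c).off)) = _
  have hlt : Nat.xor ((mkFace j b e c).vert x) (mkFace j b e c).off < 64 :=
    Nat.xor_lt_two_pow (n := 6) (hv ▸ v3) ho
  rw [hdir, code_clr hF _ hlt, ofCode_xor, hv, v4]
  simp only at v2 ⊢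
  rw [v2]
  exact (code_mk (onFace F j b e c) ⟨i, h1⟩ h2).symm

theorem testBit_image (f : Face) (l : List (ℕ × ℕ)) (e : ℕ) : (f.image l).testBit e = true ↔
    ∃ p ∈ l, 64 * (f.edge p).1 + (f.edge p).2 = e := by
  unfold Face.image
  rw [testBit_bits]
  simp only [List.mem_map, exists_exists_and_eq_and, testBit_edgeBit]

/-! ### Four-dimensional faces with few edges -/

def mask (l : List (ℕ × ℕ)) : ℕ := bits (l.map fun p => edgeBit p.1 p.2)

theorem testBit_mask (l : List (ℕ × ℕ)) (e : ℕ) : (mask l).testBit e = true ↔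
    ∃ p ∈ l, 64 * p.1 + p.2 = e := by
  unfold mask
  rw [testBit_bits]
  simp only [List.mem_map, exists_exists_and_eq_and, testBit_edgeBit]

theorem agrees_zero (P : ℕ → Bool) : Agrees P 0 0 := by
  constructor <;> intro e he <;> rw [Nat.zero_testBit] at he <;> cases he

-- The 24 squares of a four-dimensional face have three through each edge, so eight edges can
-- suffice only by meeting each square once. The search shows that a ninth edge creates nothing new:
-- each leaf contains a translate of `perfect`.
set_option maxRecDepth 100000 in
theorem base_search : ((solve baseSquares 0 0 9).all fun r => shifts.any fun s =>
    Nat.beq (Nat.land (mask (pattern s)) r.1) (mask (pattern s))) = true := by decide +kernel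

theorem baseFace_all_lt : baseFace.all < 2 ^ 384 := by decide +kernel

theorem exists_pattern {F : Vertex → Fin 6 → Bool} (hF : IsHitting F)
    (h : cnt F (w4 0 false 1 false) ≤ 9) :
    ∃ s ∈ shifts, ∀ e, (mask (pattern s)).testBit e = true → code F e = true := by
  rw [← load_all_baseFace] at h
  obtain ⟨r, hr, hr'⟩ := exists_mem_solve (code F) baseFace.all baseSquares
    (covered_of_mem_squares hF baseSquares_mask) 0 0 9 (agrees_zero _) (by
      refine le_trans (Finset.card_le_card fun e he => ?_) h
      simp only [Finset.mem_filter] at he ⊢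
      tauto)
  obtain ⟨s, hs, hsr⟩ := List.any_eq_true.1 (List.all_eq_true.1 base_search r hr)
  refine ⟨s, hs, fun e he => hr'.1 e ?_⟩
  rw [← Nat.eq_of_beq_eq_true hsr, testBit_land] at he
  exact he.2

theorem pattern_pop : ∀ s ∈ shifts,
    8 ≤ pop 400 (Nat.land (mask (pattern s)) baseFace.all) := by decide +kernel

theorem eight_le_base {F : Vertex → Fin 6 → Bool} (hF : IsHitting F) :
    8 ≤ cnt F (w4 0 false 1 false) := by
  by_contra hlt
  obtain ⟨s, hs, h⟩ := exists_pattern hF (by omega)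
  have := (pattern_pop s hs).trans (pop_le_load baseFace_all_lt h)
  rw [load_all_baseFace] at this
  omega

theorem eight_le_face {F : Vertex → Fin 6 → Bool} (hF : IsHitting F) {j e : Fin 6} (h : e ≠ j)
    (b c : Bool) : 8 ≤ cnt F (w4 j b e c) := by
  rw [← cnt_onFace_w4 hF h b c]
  exact eight_le_base (hF.onFace j b e c)

theorem pattern_lt : ∀ s ∈ shifts, ∀ p ∈ pattern s, p.1 < 6 ∧ p.2 < 64 ∧ p ∈ faceEdges := by
  decide +kernel

theorem faceEdges_lt : ∀ p ∈ faceEdges, p.1 < 6 ∧ p.2 < 64 ∧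
    baseFace.all.testBit (64 * p.1 + p.2) = true := by decide +kernel

theorem image_subset {F : Vertex → Fin 6 → Bool} (hF : IsHitting F) {j e : Fin 6} (h : e ≠ j)
    (b c : Bool) {s : ℕ} (hs : s ∈ shifts)
    (hp : ∀ a, (mask (pattern s)).testBit a = true → code (onFace F j b e c) a = true) (a : ℕ)
    (ha : ((mkFace j b e c).image (pattern s)).testBit a = true) : code F a = true := by
  rw [testBit_image] at ha
  obtain ⟨p, hps, rfl⟩ := ha
  obtain ⟨h1, h2, -⟩ := pattern_lt s hs p hps
  rw [code_edge hF h b c h1 h2]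
  exact hp _ ((testBit_mask _ _).2 ⟨p, hps, rfl⟩)

theorem exists_seed_subset {F : Vertex → Fin 6 → Bool} (hF : IsHitting F) {j e : Fin 6}
    (h : e ≠ j) {b c : Bool} (h9 : cnt F (w4 j b e c) ≤ 9) :
    ∃ s ∈ (mkFace j b e c).seeds, ∀ a, s.1.testBit a = true → code F a = true := by
  rw [← cnt_onFace_w4 hF h b c] at h9
  obtain ⟨s, hs, hp⟩ := exists_pattern (hF.onFace j b e c) h9
  exact ⟨_, List.mem_map.2 ⟨s, hs, rfl⟩, image_subset hF h b c hs hp⟩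

/-- With only eight edges on the face the pattern uses them all, so the rest of the face is
excluded; with nine only the inclusion of `exists_seed_subset` remains. -/
theorem exists_seed {F : Vertex → Fin 6 → Bool} (hF : IsHitting F) {j e : Fin 6}
    (h : e ≠ j) {b c : Bool} (h8 : cnt F (w4 j b e c) ≤ 8) :
    ∃ s ∈ (mkFace j b e c).seeds, Agrees (code F) s.1 s.2 := by
  rw [← cnt_onFace_w4 hF h b c] at h8
  obtain ⟨s, hs, hp⟩ := exists_pattern (hF.onFace j b e c) (by omega)
  refine ⟨_, List.mem_map.2 ⟨s, hs, rfl⟩, image_subset hF h b c hs hp, fun a ha => ?_⟩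
  have ha' : ((mkFace j b e c).all ^^^ (mkFace j b e c).image (pattern s)).testBit a = true := ha
  rw [Nat.testBit_xor] at ha'
  by_cases h1 : ((mkFace j b e c).image (pattern s)).testBit a = true
  · exfalso
    obtain ⟨p, hps, rfl⟩ := (testBit_image _ _ _).1 h1
    have h2 : (mkFace j b e c).all.testBit
        (64 * ((mkFace j b e c).edge p).1 + ((mkFace j b e c).edge p).2) = true :=
      (testBit_image _ _ _).2 ⟨p, (pattern_lt s hs p hps).2.2, rfl⟩
    rw [h1, h2] at ha'
    cases ha'
  · rw [Bool.not_eq_true] at h1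
    rw [h1, Bool.xor_false] at ha'
    obtain ⟨p, hp1, rfl⟩ := (testBit_image _ _ _).1 ha'
    obtain ⟨g1, g2, g3⟩ := faceEdges_lt p hp1
    rw [code_edge hF h b c g1 g2]
    refine Agrees.of_le_pop baseFace_all_lt hp ?_ (pattern_pop s hs) _ (by omega) g3 ?_
    · rw [load_all_baseFace]
      exact h8
    · intro h3
      obtain ⟨q, hq, hqp⟩ := (testBit_mask _ _).1 h3
      obtain ⟨q1, q2, -⟩ := pattern_lt s hs q hq
      have : q = p := by
        ext <;> omega
      subst this
      have := (testBit_image (mkFace j b e c) _ _).2 ⟨q, hq, rfl⟩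
      rw [h1] at this
      cases this

theorem sum_le_of_others {ι : Type*} [DecidableEq ι] {S : Finset ι} {f : ι → ℕ}
    (hS : S.card = 10) {x y : ι} (hx : x ∈ S) (hy : y ∈ S) (hxy : x ≠ y)
    (h : ∀ z ∈ S, z ≠ x → z ≠ y → 10 ≤ f z) : f x + f y + 80 ≤ ∑ z ∈ S, f z := by
  have hy' : y ∈ S.erase x := Finset.mem_erase.2 ⟨hxy.symm, hy⟩
  rw [← Finset.add_sum_erase _ _ hx, ← Finset.add_sum_erase _ _ hy']
  have h1 : ∑ _z ∈ (S.erase x).erase y, 10 ≤ ∑ z ∈ (S.erase x).erase y, f z := by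
    refine Finset.sum_le_sum fun z hz => ?_
    simp only [Finset.mem_erase] at hz
    exact h z hz.2.2 hz.2.1 hz.1
  rw [Finset.sum_const, Finset.card_erase_of_mem hy', Finset.card_erase_of_mem hx, hS] at h1
  simp only [smul_eq_mul] at h1
  omega

def faces (j : Fin 6) : Finset (Fin 6 × Bool) := Finset.univ.erase j ×ˢ Finset.univ

theorem mem_faces {j : Fin 6} {x : Fin 6 × Bool} : x ∈ faces j ↔ x.1 ≠ j := by
  simp [faces]

theorem card_faces (j : Fin 6) : (faces j).card = 10 := by
  simp [faces, Finset.card_product, Finset.card_erase_of_mem]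

theorem sum_faces_eq (F : Vertex → Fin 6 → Bool) (j : Fin 6) (b : Bool) :
    ∑ x ∈ faces j, cnt F (w4 j b x.1 x.2) = 4 * cnt F (w5 j b) := by
  rw [← sum_faces, faces, Finset.sum_product]
  refine Finset.sum_congr rfl fun e _ => ?_
  rw [Fintype.sum_bool, add_comm]

/-- If all faces but two have at least ten edges, those two are the minimal ones. -/
theorem add_le_of_others {F : Vertex → Fin 6 → Bool} {j : Fin 6} {b : Bool}
    (h24 : cnt F (w5 j b) ≤ 24) {x y : Fin 6 × Bool} (hx : x.1 ≠ j) (hy : y.1 ≠ j) (hxy : x ≠ y)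
    (h : ∀ z : Fin 6 × Bool, z.1 ≠ j → z ≠ x → z ≠ y → 10 ≤ cnt F (w4 j b z.1 z.2)) :
    cnt F (w4 j b x.1 x.2) + cnt F (w4 j b y.1 y.2) ≤ 16 := by
  have := sum_le_of_others (S := faces j)
    (f := fun z : Fin 6 × Bool => cnt F (w4 j b z.1 z.2)) (card_faces j)
    (mem_faces.2 hx) (mem_faces.2 hy) hxy fun z hz => h z (mem_faces.1 hz)
  rw [sum_faces_eq] at this
  omega

/-- The ten face counts sum to at most 96. If all but one were at least 10, the sum would be at
least `8 + 9 * 10 = 98`. -/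
theorem exists_two_faces {F : Vertex → Fin 6 → Bool} (hF : IsHitting F) {j : Fin 6} {b : Bool}
    (h24 : cnt F (w5 j b) ≤ 24) : ∃ x y : Fin 6 × Bool, x.1 ≠ j ∧ y.1 ≠ j ∧ x ≠ y ∧
      cnt F (w4 j b x.1 x.2) ≤ 9 ∧ cnt F (w4 j b y.1 y.2) ≤ 9 := by
  by_contra hno
  push Not at hno
  obtain ⟨e, he⟩ : ∃ e : Fin 6, e ≠ j := exists_ne j
  obtain ⟨x, hx, hx'⟩ : ∃ x : Fin 6 × Bool, x.1 ≠ j ∧ ∀ z : Fin 6 × Bool, z.1 ≠ j → z ≠ x →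
      10 ≤ cnt F (w4 j b z.1 z.2) := by
    by_cases hex : ∃ x : Fin 6 × Bool, x.1 ≠ j ∧ cnt F (w4 j b x.1 x.2) ≤ 9
    · obtain ⟨x, hx, hx9⟩ := hex
      exact ⟨x, hx, fun z hz hzx => hno x z hx hz (Ne.symm hzx) hx9⟩
    · push Not at hex
      exact ⟨(e, false), he, fun z hz _ => hex z hz⟩
  obtain ⟨y, hy, hyx⟩ : ∃ y : Fin 6 × Bool, y.1 ≠ j ∧ y ≠ x :=
    ⟨(x.1, !x.2), hx, fun h => by simpa using congrArg Prod.snd h⟩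
  have h1 := add_le_of_others h24 hx hy hyx.symm fun z hz hzx _ => hx' z hz hzx
  have h2 := eight_le_face hF hx b x.2
  have h3 := hx' y hy hyx
  omega

/-! ### Normal position of two faces of the subcube `v 0 = false` -/

/-- Invariance under the symmetries of the cube which keep the subcube `v 0 = false`. -/
def Invariant (Q : (Vertex → Fin 6 → Bool) → Prop) : Prop :=
  ∀ F, IsHitting F → (∀ t : Vertex, t 0 = false → Q (refl F t) → Q F) ∧
    ∀ a b : Fin 6, a ≠ 0 → b ≠ 0 → Q (perm F (Equiv.swap a b)) → Q F

/-- Stands for `G` being obtained from `F` by allowed symmetries: pulling invariant properties back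
from `G` to `F` is all that is needed of them. -/
def Moved (F G : Vertex → Fin 6 → Bool) : Prop := ∀ Q, Invariant Q → Q G → Q F

/-- Reflecting coordinate `e` when `c` is true, and then exchanging `a` with `e`, brings the face `v
e = c` to `v a = false`; faces in other directions are at most renamed. -/
theorem exists_move {F : Vertex → Fin 6 → Bool} (hF : IsHitting F) {a e : Fin 6} (ha : a ≠ 0)
    (he : e ≠ 0) (c : Bool) : ∃ G, IsHitting G ∧ Moved F G ∧
      cnt G (w5 0 false) = cnt F (w5 0 false) ∧
      (∀ y, cnt G (w4 0 false a y) = cnt F (w4 0 false e (y ^^ c))) ∧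
      ∀ x y, x ≠ e → cnt G (w4 0 false (Equiv.swap a e x) y) = cnt F (w4 0 false x y) := by
  let t : Vertex := fun k => decide (k = e) && c
  have ht0 : t 0 = false := by simp [t, Ne.symm he]
  have h0 : Equiv.swap a e 0 = 0 := Equiv.swap_apply_of_ne_of_ne (Ne.symm ha) (Ne.symm he)
  refine ⟨perm (refl F t) (Equiv.swap a e), (hF.refl t).perm _, fun Q hQ h => ?_, ?_,
    fun y => ?_, fun x y hx => ?_⟩
  · exact (hQ F hF).1 t ht0 ((hQ _ (hF.refl t)).2 a e ha he h)
  · rw [cnt_perm_w5 (hF.refl t), cnt_refl_w5 hF, Equiv.symm_swap, h0, ht0]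
    rfl
  · rw [cnt_perm_w4 (hF.refl t), cnt_refl_w4 hF, Equiv.symm_swap, h0, ht0,
      Equiv.swap_apply_left]
    simp [t]
  · rw [cnt_perm_w4 (hF.refl t), cnt_refl_w4 hF, Equiv.symm_swap, h0, ht0,
      Equiv.swap_apply_self]
    simp [t, hx]

theorem Moved.trans {F G H : Vertex → Fin 6 → Bool} (h : Moved F G) (h' : Moved G H) :
    Moved F H := fun Q hQ hH => h Q hQ (h' Q hQ hH)

theorem shifts_spec : ∀ s ∈ shifts, s < 64 ∧ s.testBit 0 = false ∧ s.testBit 1 = false ∧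
    s.testBit 2 = false := by decide +kernel

theorem perfect_lt : ∀ p ∈ perfect, p.1 < 6 ∧ p.2 < 64 := by decide

/-- The shift that turns the pattern into `perfect` fixes coordinates 0, 1 and 2, so it disturbs
neither the base face nor a crossing face already placed in direction 2. -/
theorem exists_perfect {F : Vertex → Fin 6 → Bool} (hF : IsHitting F)
    (h9 : cnt F (w4 0 false 1 false) ≤ 9) : ∃ G, IsHitting G ∧ Moved F G ∧
      cnt G (w5 0 false) = cnt F (w5 0 false) ∧
      (∀ y, cnt G (w4 0 false 1 y) = cnt F (w4 0 false 1 y)) ∧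
      (∀ y, cnt G (w4 0 false 2 y) = cnt F (w4 0 false 2 y)) ∧
      ∀ e, (mask perfect).testBit e = true → code G e = true := by
  obtain ⟨s, hs, h⟩ := exists_pattern hF h9
  obtain ⟨hlt, h0, h1, h2⟩ := shifts_spec s hs
  have h0' : ofCode s 0 = false := h0
  have h1' : ofCode s 1 = false := h1
  have h2' : ofCode s 2 = false := h2
  refine ⟨refl F (ofCode s), hF.refl _, fun Q hQ hG => (hQ F hF).1 _ h0' hG, ?_, fun y => ?_,
    fun y => ?_, fun e he => ?_⟩
  · rw [cnt_refl_w5 hF, h0', Bool.xor_false]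
  · rw [cnt_refl_w4 hF, h0', h1', Bool.xor_false, Bool.xor_false]
  · rw [cnt_refl_w4 hF, h0', h2', Bool.xor_false, Bool.xor_false]
  · obtain ⟨⟨i, x⟩, hp, rfl⟩ := (testBit_mask _ _).1 he
    obtain ⟨hi, hx⟩ := perfect_lt _ hp
    simp only at hi hx
    have h3 := h (64 * i + clr i (Nat.xor x s))
      ((testBit_mask _ _).2 ⟨_, List.mem_map.2 ⟨(i, x), hp, rfl⟩, rfl⟩)
    have h4 := code_clr hF ⟨i, hi⟩ (x := Nat.xor x s) (Nat.xor_lt_two_pow (n := 6) hx hlt)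
    have h5 := code_mk (refl F (ofCode s)) ⟨i, hi⟩ hx
    simp only at h4 h5
    rw [h3] at h4
    rw [h5, h4, ofCode_xor]
    rfl

theorem exists_cross {F : Vertex → Fin 6 → Bool} (hF : IsHitting F) {e e' : Fin 6} (he : e ≠ 0)
    (he' : e' ≠ 0) (hne : e' ≠ e) {c : Bool} (c' : Bool) (h9 : cnt F (w4 0 false e c) ≤ 9) :
    ∃ G, IsHitting G ∧ Moved F G ∧ cnt G (w5 0 false) = cnt F (w5 0 false) ∧
      cnt G (w4 0 false 1 false) = cnt F (w4 0 false e c) ∧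
      cnt G (w4 0 false 2 false) = cnt F (w4 0 false e' c') ∧
      ∀ e, (mask perfect).testBit e = true → code G e = true := by
  obtain ⟨G₁, hG₁, m₁, f₁, a₁, b₁⟩ := exists_move hF (a := 1) (by decide) he c
  have hx0 : Equiv.swap 1 e e' ≠ 0 := by
    revert he he' hne
    clear * -
    revert e e'
    decide
  have hx1 : Equiv.swap 1 e e' ≠ 1 := by
    intro h
    rw [Equiv.swap_apply_eq_iff, Equiv.swap_apply_left] at h
    exact hne h
  -- After the first move the second face lies in direction `Equiv.swap 1 e e'`, which is neither 0
  -- nor 1; moving it to 2 therefore keeps the first face in direction 1.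
  obtain ⟨G₂, hG₂, m₂, f₂, a₂, b₂⟩ := exists_move hG₁ (a := 2) (by decide) hx0 c'
  have e₁ := b₂ 1 false (Ne.symm hx1)
  rw [Equiv.swap_apply_of_ne_of_ne (by decide) (Ne.symm hx1), a₁ false, Bool.false_xor] at e₁
  obtain ⟨G₃, hG₃, m₃, f₃, a₃, b₃, c₃⟩ := exists_perfect hG₂ (by omega)
  refine ⟨G₃, hG₃, (m₁.trans m₂).trans m₃, by omega, by rw [a₃, e₁], ?_, c₃⟩
  rw [b₃, a₂, Bool.false_xor, b₁ _ _ hne]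

theorem exists_parallel {F : Vertex → Fin 6 → Bool} (hF : IsHitting F) {e : Fin 6} (he : e ≠ 0)
    {c : Bool} (h9 : cnt F (w4 0 false e c) ≤ 9) :
    ∃ G, IsHitting G ∧ Moved F G ∧ cnt G (w5 0 false) = cnt F (w5 0 false) ∧
      cnt G (w4 0 false 1 false) = cnt F (w4 0 false e c) ∧
      cnt G (w4 0 false 1 true) = cnt F (w4 0 false e (!c)) ∧
      ∀ e, (mask perfect).testBit e = true → code G e = true := by
  obtain ⟨G₁, hG₁, m₁, f₁, a₁, -⟩ := exists_move hF (a := 1) (by decide) he c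
  have e₁ := a₁ false
  have e₂ := a₁ true
  rw [Bool.false_xor] at e₁
  rw [Bool.true_xor] at e₂
  obtain ⟨G₃, hG₃, m₃, f₃, a₃, -, c₃⟩ := exists_perfect hG₁ (by omega)
  exact ⟨G₃, hG₃, m₁.trans m₃, by omega, by rw [a₃, e₁], by rw [a₃, e₂], c₃⟩

/-! ### Five-dimensional subcubes with at most 24 edges -/

def base : ℕ × ℕ := (mask perfect, Nat.xor baseFace.all (mask perfect))

def solveSub (inn out : ℕ) : List (ℕ × ℕ) :=
  solveFrom (q5Squares 0 0) (q5Mask 0 0) 24 (Nat.lor base.1 inn) out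

def exactLeaves (f : Face) : List (ℕ × ℕ) :=
  f.seeds.flatMap fun s => solveSub s.1 (Nat.lor base.2 s.2)

def thirdFaces : List Face :=
  [⟨0, 0, 1, 1⟩, ⟨0, 0, 2, 1⟩, ⟨0, 0, 3, 0⟩, ⟨0, 0, 3, 1⟩, ⟨0, 0, 4, 0⟩, ⟨0, 0, 4, 1⟩,
    ⟨0, 0, 5, 0⟩, ⟨0, 0, 5, 1⟩]

/-- Faces with nine edges are only known to contain a pattern, so nothing is excluded here. A third
such face supplies the missing information, and combinations forcing more than nine edges into one
of the first two faces are dropped. -/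
def tripleLeaves : List (ℕ × ℕ) :=
  (Face.seeds ⟨0, 0, 2, 0⟩).flatMap fun s => thirdFaces.flatMap fun f => f.seeds.flatMap fun t =>
    let inn := Nat.lor s.1 t.1
    bif Nat.ble (pop 400 (Nat.land (Nat.lor base.1 inn) baseFace.all)) 9 &&
        Nat.ble (pop 400 (Nat.land (Nat.lor base.1 inn) (Face.all ⟨0, 0, 2, 0⟩))) 9 then
      solveSub inn 0
    else []

def dirPop (r : ℕ × ℕ) (d : ℕ) : ℕ := pop 400 (Nat.land r.1 (dirMask d))

/-- Under a total of at most 24, the lower bounds for the five directions must be exact once they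
add up to 24, so their parities are those of the true counts. The last condition leaves at most 8
edges for the base face. -/
def leafOk (r : ℕ × ℕ) : Bool :=
  Nat.ble 24 (dirPop r 1 + dirPop r 2 + dirPop r 3 + dirPop r 4 + dirPop r 5) &&
    (([1, 2, 3, 4, 5].all fun d => Nat.beq (Nat.land (dirPop r d) 1) 0) &&
      Nat.ble 16 (pop 400 (Nat.land r.1 (Face.all ⟨0, 0, 1, 1⟩)) + dirPop r 1))

set_option maxRecDepth 100000 in
theorem cross_check : (exactLeaves ⟨0, 0, 2, 0⟩).all leafOk = true := by decide +kernel

set_option maxRecDepth 100000 in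
theorem parallel_check : (exactLeaves ⟨0, 0, 1, 1⟩).all leafOk = true := by decide +kernel

set_option maxRecDepth 100000 in
theorem triple_check : tripleLeaves.all leafOk = true := by decide +kernel

theorem load_dirMask (F : Vertex → Fin 6 → Bool) {d : Fin 6} (hd : d ≠ 0) :
    load (code F) (dirMask d) = cnt F (wd5 0 false d) := by
  refine load_eq_cnt F ?_ fun v i => by unfold wd5; split_ifs <;> simp
  revert d
  decide +kernel

theorem dirMask_lt : ∀ d : Fin 6, dirMask d < 2 ^ 384 := by decide +kernel

theorem load_all_opposite (F : Vertex → Fin 6 → Bool) :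
    load (code F) (Face.all ⟨0, 0, 1, 1⟩) = cnt F (w4 0 false 1 true) :=
  load_eq_cnt F (by decide +kernel) fun v i => by unfold w4; split_ifs <;> simp

theorem all_lt : Face.all ⟨0, 0, 1, 1⟩ < 2 ^ 384 ∧ Face.all ⟨0, 0, 2, 0⟩ < 2 ^ 384 := by
  decide +kernel

/-- Exactly 24 edges in the subcube `v 0 = false`, evenly many in each direction. -/
def IsTight (F : Vertex → Fin 6 → Bool) : Prop :=
  cnt F (w5 0 false) = 24 ∧ ∀ d, d ≠ 0 → Even (cnt F (wd5 0 false d))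

theorem invariant_isTight : Invariant IsTight := by
  refine fun F hF => ⟨fun t ht h => ?_, fun a b ha hb h => ?_⟩
  · unfold IsTight at h ⊢
    simp only [cnt_refl_w5 hF, cnt_refl_wd5 hF, ht, Bool.xor_false] at h
    exact h
  · have h0 : Equiv.swap a b 0 = 0 := Equiv.swap_apply_of_ne_of_ne (Ne.symm ha) (Ne.symm hb)
    unfold IsTight at h ⊢
    simp only [cnt_perm_w5 hF, cnt_perm_wd5 hF, Equiv.symm_swap, h0] at h
    refine ⟨h.1, fun d hd => ?_⟩
    have := h.2 (Equiv.swap a b d) fun h' =>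
      hd (by rw [Equiv.swap_apply_eq_iff, h0] at h'; exact h')
    rwa [Equiv.swap_apply_self] at this

theorem dirPop_le {F : Vertex → Fin 6 → Bool} {r : ℕ × ℕ} (h : Agrees (code F) r.1 r.2)
    (d : Fin 6) (hd : d ≠ 0) : dirPop r d ≤ cnt F (wd5 0 false d) := by
  rw [← load_dirMask F hd]
  exact pop_le_load (dirMask_lt d) h.1

theorem sum_erase_zero (f : Fin 6 → ℕ) :
    ∑ d ∈ Finset.univ.erase 0, f d = f 1 + f 2 + f 3 + f 4 + f 5 := by
  have h : (Finset.univ.erase 0 : Finset (Fin 6)) = {1, 2, 3, 4, 5} := by decide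
  rw [h]
  simp [Finset.sum_insert, add_assoc]

theorem even_of_land {n : ℕ} (h : Nat.beq (Nat.land n 1) 0 = true) : Even n := by
  have h' : n &&& 1 = 0 := Nat.eq_of_beq_eq_true h
  rw [Nat.and_one_is_mod] at h'
  exact Nat.even_iff.2 h'

theorem IsTight.of_leafOk {F : Vertex → Fin 6 → Bool} (h24 : cnt F (w5 0 false) ≤ 24)
    {r : ℕ × ℕ} (hr : leafOk r = true) (h : Agrees (code F) r.1 r.2) :
    IsTight F ∧ cnt F (w4 0 false 1 false) ≤ 8 := by
  simp only [leafOk, Bool.and_eq_true, List.all_cons, List.all_nil, Nat.ble_eq] at hr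
  obtain ⟨h1, ⟨e1, e2, e3, e4, e5, -⟩, h2⟩ := hr
  have l1 := dirPop_le h 1 (by decide)
  have l2 := dirPop_le h 2 (by decide)
  have l3 := dirPop_le h 3 (by decide)
  have l4 := dirPop_le h 4 (by decide)
  have l5 := dirPop_le h 5 (by decide)
  have hs := cnt_w5_eq_sum F 0 false
  rw [sum_erase_zero] at hs
  have hw := cnt_w5_eq F (j := 0) (e := 1) (by decide) false
  have hl : pop 400 (Nat.land r.1 (Face.all ⟨0, 0, 1, 1⟩)) ≤ cnt F (w4 0 false 1 true) := by
    rw [← load_all_opposite]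
    exact pop_le_load all_lt.1 h.1
  change dirPop r 1 ≤ _ at l1
  change dirPop r 2 ≤ _ at l2
  change dirPop r 3 ≤ _ at l3
  change dirPop r 4 ≤ _ at l4
  change dirPop r 5 ≤ _ at l5
  refine ⟨⟨by omega, fun d hd => ?_⟩, by omega⟩
  have e1' : cnt F (wd5 0 false 1) = dirPop r 1 := by omega
  have e2' : cnt F (wd5 0 false 2) = dirPop r 2 := by omega
  have e3' : cnt F (wd5 0 false 3) = dirPop r 3 := by omega
  have e4' : cnt F (wd5 0 false 4) = dirPop r 4 := by omega
  have e5' : cnt F (wd5 0 false 5) = dirPop r 5 := by omega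
  fin_cases d
  · exact absurd rfl hd
  · exact e1' ▸ even_of_land e1
  · exact e2' ▸ even_of_land e2
  · exact e3' ▸ even_of_land e3
  · exact e4' ▸ even_of_land e4
  · exact e5' ▸ even_of_land e5

theorem perfect_pop : 8 ≤ pop 400 (Nat.land (mask perfect) baseFace.all) := by decide +kernel

theorem lt_of_testBit {m e : ℕ} (hm : m < 2 ^ 384) (h : m.testBit e = true) : e < 384 := by
  by_contra hge
  rw [Nat.testBit_lt_two_pow (hm.trans_le (Nat.pow_le_pow_right (by norm_num) (by omega)))] at h
  cases h

theorem agrees_base {F : Vertex → Fin 6 → Bool} (h8 : cnt F (w4 0 false 1 false) ≤ 8)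
    (h : ∀ e, (mask perfect).testBit e = true → code F e = true) :
    Agrees (code F) base.1 base.2 := by
  refine ⟨h, fun e he => ?_⟩
  have he' : (baseFace.all ^^^ mask perfect).testBit e = true := he
  rw [Nat.testBit_xor] at he'
  have hsub : (mask perfect).testBit e = true → baseFace.all.testBit e = true := by
    have : Nat.land (mask perfect) baseFace.all = mask perfect := by decide +kernel
    intro h1
    rw [← this, testBit_land] at h1
    exact h1.2
  have hm : baseFace.all.testBit e = true ∧ (mask perfect).testBit e = false := by
    revert he' hsub
    cases baseFace.all.testBit e <;> cases (mask perfect).testBit e <;> simp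
  refine Agrees.of_le_pop baseFace_all_lt h ?_ perfect_pop e
    (lt_of_testBit baseFace_all_lt hm.1) hm.1
    (by rw [hm.2]; decide)
  rw [load_all_baseFace]
  exact h8

theorem exists_mem_solveSub {F : Vertex → Fin 6 → Bool} (hF : IsHitting F)
    (h24 : cnt F (w5 0 false) ≤ 24) {inn out : ℕ} (h : Agrees (code F) (Nat.lor base.1 inn) out) :
    ∃ r ∈ solveSub inn out, Agrees (code F) r.1 r.2 :=
  exists_mem_solveFrom (q5Mask_lt 0 false) (covered_of_mem_squares hF (q5Squares_mask 0 false)) h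
    ((load_q5Mask F 0 false).trans_le h24)

theorem exists_mem_exactLeaves {F : Vertex → Fin 6 → Bool} (hF : IsHitting F)
    (h24 : cnt F (w5 0 false) ≤ 24) (h8 : cnt F (w4 0 false 1 false) ≤ 8)
    (h : ∀ e, (mask perfect).testBit e = true → code F e = true) {e : Fin 6} (he : e ≠ 0) {c : Bool}
    (h8' : cnt F (w4 0 false e c) ≤ 8) :
    ∃ r ∈ exactLeaves (mkFace 0 false e c), Agrees (code F) r.1 r.2 := by
  obtain ⟨s, hs, ha⟩ := exists_seed hF he h8'
  have hb := agrees_base h8 h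
  obtain ⟨r, hr, har⟩ := exists_mem_solveSub hF h24 (hb.lor ha)
  exact ⟨r, List.mem_flatMap.2 ⟨s, hs, hr⟩, har⟩

theorem mem_thirdFaces : ∀ z : Fin 6 × Bool, z.1 ≠ 0 → z ≠ (1, false) → z ≠ (2, false) →
    ∃ f ∈ thirdFaces, f = mkFace 0 false z.1 z.2 := by
  rintro ⟨e, c⟩ h0 h1 h2
  fin_cases e <;> cases c <;> simp_all [thirdFaces, mkFace]

theorem mkFace_two : mkFace 0 false 2 false = ⟨0, 0, 2, 0⟩ := rfl

theorem exists_mem_tripleLeaves {F : Vertex → Fin 6 → Bool} (hF : IsHitting F)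
    (h24 : cnt F (w5 0 false) ≤ 24) (h1 : cnt F (w4 0 false 1 false) ≤ 9)
    (h2 : cnt F (w4 0 false 2 false) ≤ 9)
    (h : ∀ e, (mask perfect).testBit e = true → code F e = true) {z : Fin 6 × Bool} (hz : z.1 ≠ 0)
    (hz1 : z ≠ (1, false)) (hz2 : z ≠ (2, false)) (h3 : cnt F (w4 0 false z.1 z.2) ≤ 9) :
    ∃ r ∈ tripleLeaves, Agrees (code F) r.1 r.2 := by
  obtain ⟨s, hs, has⟩ := exists_seed_subset hF (j := 0) (e := 2) (by decide) h2
  rw [mkFace_two] at hs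
  obtain ⟨t, ht, hat⟩ := exists_seed_subset hF hz h3
  obtain ⟨f, hf, rfl⟩ := mem_thirdFaces z hz hz1 hz2
  have ha : ∀ e, (Nat.lor base.1 (Nat.lor s.1 t.1)).testBit e = true → code F e = true := by
    intro e he
    rw [testBit_lor, testBit_lor] at he
    rcases he with he | he | he
    · exact h e he
    · exact has e he
    · exact hat e he
  have hg : Agrees (code F) (Nat.lor base.1 (Nat.lor s.1 t.1)) 0 :=
    ⟨ha, (agrees_zero _).2⟩
  obtain ⟨r, hr, har⟩ := exists_mem_solveSub hF h24 hg
  refine ⟨r, List.mem_flatMap.2 ⟨s, hs, List.mem_flatMap.2 ⟨_, hf, List.mem_flatMap.2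
    ⟨t, ht, ?_⟩⟩⟩, har⟩
  have p1 := (pop_le_load (k := 400) baseFace_all_lt ha).trans
    ((load_all_baseFace F).trans_le h1)
  have p2 := (pop_le_load (k := 400) all_lt.2 ha).trans ((load_all_face F).trans_le h2)
  dsimp only
  rw [Nat.ble_eq_true_of_le p1, Nat.ble_eq_true_of_le p2, Bool.and_self, cond_true]
  exact hr

/-- A third face with at most nine edges leads to `tripleLeaves`. Without one, the sum over the
faces leaves exactly eight edges for each of the two given faces, so their patterns are complete and
`exactLeaves` applies. -/
theorem tight_of_cross {F : Vertex → Fin 6 → Bool} (hF : IsHitting F)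
    (h24 : cnt F (w5 0 false) ≤ 24) (h1 : cnt F (w4 0 false 1 false) ≤ 9)
    (h2 : cnt F (w4 0 false 2 false) ≤ 9)
    (h : ∀ e, (mask perfect).testBit e = true → code F e = true) :
    IsTight F ∧ cnt F (w4 0 false 1 false) ≤ 8 := by
  by_cases h3 : ∃ z : Fin 6 × Bool, z.1 ≠ 0 ∧ z ≠ (1, false) ∧ z ≠ (2, false) ∧
      cnt F (w4 0 false z.1 z.2) ≤ 9
  · obtain ⟨z, hz, hz1, hz2, hz9⟩ := h3
    obtain ⟨r, hr, ha⟩ := exists_mem_tripleLeaves hF h24 h1 h2 h hz hz1 hz2 hz9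
    exact IsTight.of_leafOk h24 (List.all_eq_true.1 triple_check r hr) ha
  · push Not at h3
    have := add_le_of_others h24 (x := (1, false)) (y := (2, false)) (by decide) (by decide)
      (by decide) h3
    have g1 := eight_le_face hF (j := 0) (e := 1) (by decide) false false
    have g2 := eight_le_face hF (j := 0) (e := 2) (by decide) false false
    simp only at this
    obtain ⟨r, hr, ha⟩ := exists_mem_exactLeaves hF h24 (by omega) h (e := 2) (by decide)
      (c := false) (by omega)
    exact IsTight.of_leafOk h24 (List.all_eq_true.1 cross_check r hr) ha

/-- Either a crossing face also has at most nine edges, or all faces outside this parallel pair have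
at least ten. In the second case both faces of the pair have exactly eight, and `parallel_check`
applies. -/
theorem tight_of_face {F : Vertex → Fin 6 → Bool} (hF : IsHitting F)
    (h24 : cnt F (w5 0 false) ≤ 24) {e : Fin 6} (he : e ≠ 0) {c : Bool}
    (h9 : cnt F (w4 0 false e c) ≤ 9) : IsTight F ∧ cnt F (w4 0 false e c) ≤ 8 := by
  by_cases h3 : ∃ z : Fin 6 × Bool, z.1 ≠ 0 ∧ z.1 ≠ e ∧ cnt F (w4 0 false z.1 z.2) ≤ 9
  · obtain ⟨z, hz, hze, hz9⟩ := h3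
    obtain ⟨G, hG, hm, k1, k2, k3, hp⟩ := exists_cross hF he hz hze z.2 h9
    obtain ⟨ht, h8⟩ := tight_of_cross hG (by omega) (by omega) (by omega) hp
    exact ⟨hm _ invariant_isTight ht, by omega⟩
  · push Not at h3
    have := add_le_of_others h24 (x := (e, c)) (y := (e, !c)) he he (by simp) (by
      intro z hz hz1 hz2
      refine h3 z hz fun hze => ?_
      obtain ⟨a, b⟩ := z
      simp only at hze
      subst hze
      cases b <;> cases c <;> simp_all)
    have g1 := eight_le_face hF he false c
    have g2 := eight_le_face hF he false (!c)
    simp only at this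
    obtain ⟨G, hG, hm, k1, k2, k3, hp⟩ := exists_parallel hF he h9
    obtain ⟨r, hr, ha⟩ := exists_mem_exactLeaves hG (by omega) (by omega) hp (e := 1) (by decide)
      (c := true) (by omega)
    obtain ⟨ht, h8⟩ := IsTight.of_leafOk (by omega) (List.all_eq_true.1 parallel_check r hr) ha
    exact ⟨hm _ invariant_isTight ht, by omega⟩

theorem isTight {F : Vertex → Fin 6 → Bool} (hF : IsHitting F) (h24 : cnt F (w5 0 false) ≤ 24) :
    IsTight F := by
  obtain ⟨x, -, hx, -, -, h9, -⟩ := exists_two_faces hF h24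
  exact (tight_of_face hF h24 hx h9).1

/-- Moves the subcube `v j = b` to `v 0 = false`. -/
def onSub (F : Vertex → Fin 6 → Bool) (j : Fin 6) (b : Bool) : Vertex → Fin 6 → Bool :=
  perm (refl F fun _ => b) (Equiv.swap 0 j)

theorem IsHitting.onSub {F : Vertex → Fin 6 → Bool} (hF : IsHitting F) (j : Fin 6) (b : Bool) :
    IsHitting (onSub F j b) := (hF.refl _).perm _

theorem cnt_onSub_w5 {F : Vertex → Fin 6 → Bool} (hF : IsHitting F) (j : Fin 6) (b : Bool) :
    cnt (onSub F j b) (w5 0 false) = cnt F (w5 j b) := by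
  unfold onSub
  rw [cnt_perm_w5 (hF.refl _), cnt_refl_w5 hF, Equiv.symm_swap, Equiv.swap_apply_left,
    Bool.false_xor]

theorem cnt_onSub_wd5 {F : Vertex → Fin 6 → Bool} (hF : IsHitting F) (j : Fin 6) (b : Bool)
    (d : Fin 6) : cnt (onSub F j b) (wd5 0 false (Equiv.swap 0 j d)) = cnt F (wd5 j b d) := by
  unfold onSub
  rw [cnt_perm_wd5 (hF.refl _), cnt_refl_wd5 hF, Equiv.symm_swap, Equiv.swap_apply_left,
    Equiv.swap_apply_self, Bool.false_xor]

theorem cnt_onSub_w4 {F : Vertex → Fin 6 → Bool} (hF : IsHitting F) (j : Fin 6) (b : Bool)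
    (e : Fin 6) (c : Bool) :
    cnt (onSub F j b) (w4 0 false (Equiv.swap 0 j e) (c ^^ b)) = cnt F (w4 j b e c) := by
  unfold onSub
  rw [cnt_perm_w4 (hF.refl _), cnt_refl_w4 hF, Equiv.symm_swap, Equiv.swap_apply_left,
    Equiv.swap_apply_self, Bool.false_xor, Bool.xor_assoc, Bool.xor_self, Bool.xor_false]

theorem swap_ne_zero {j d : Fin 6} (h : d ≠ j) : Equiv.swap 0 j d ≠ 0 := fun h' =>
  h (by rw [Equiv.swap_apply_eq_iff, Equiv.swap_apply_left] at h'; exact h')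

theorem cnt_w5_eq_of_le {F : Vertex → Fin 6 → Bool} (hF : IsHitting F) {j : Fin 6} {b : Bool}
    (h : cnt F (w5 j b) ≤ 24) : cnt F (w5 j b) = 24 := by
  rw [← cnt_onSub_w5 hF] at h ⊢
  exact (isTight (hF.onSub j b) h).1

theorem le_cnt_w5 {F : Vertex → Fin 6 → Bool} (hF : IsHitting F) (j : Fin 6) (b : Bool) :
    24 ≤ cnt F (w5 j b) := by
  by_contra h
  have := cnt_w5_eq_of_le hF (j := j) (b := b) (by omega)
  omega

theorem even_cnt_wd5 {F : Vertex → Fin 6 → Bool} (hF : IsHitting F) {j d : Fin 6} {b : Bool}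
    (h : cnt F (w5 j b) ≤ 24) (hd : d ≠ j) : Even (cnt F (wd5 j b d)) := by
  rw [← cnt_onSub_w5 hF] at h
  rw [← cnt_onSub_wd5 hF]
  exact (isTight (hF.onSub j b) h).2 _ (swap_ne_zero hd)

theorem cnt_w4_le {F : Vertex → Fin 6 → Bool} (hF : IsHitting F) {j e : Fin 6} {b c : Bool}
    (h : cnt F (w5 j b) ≤ 24) (he : e ≠ j) (h9 : cnt F (w4 j b e c) ≤ 9) :
    cnt F (w4 j b e c) ≤ 8 := by
  rw [← cnt_onSub_w5 hF] at h
  rw [← cnt_onSub_w4 hF] at h9 ⊢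
  exact (tight_of_face (hF.onSub j b) h (swap_ne_zero he) h9).2

/-! ### Completing a five-dimensional subcube to the whole cube -/

/-- Each unordered pair of positions occurs in one order only, which is why `mem_pairsWith` is a
disjunction. -/
def pairsWith {α β : Type} (l : List α) (k : α → α → List β) : List β :=
  l.rec [] fun a as ih => as.flatMap (k a) ++ ih

def q5Faces (j b : ℕ) : List Face := [0, 1, 2, 3, 4, 5].flatMap fun e =>
  bif Nat.beq e j then [] else [⟨j, b, e, 0⟩, ⟨j, b, e, 1⟩]

/-- Excludes the remaining edges of `m` once there are 24 included ones. -/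
def close (m : ℕ) (r : ℕ × ℕ) : ℕ × ℕ :=
  bif Nat.ble 24 (pop 400 (Nat.land r.1 m)) then
    (r.1, Nat.lor r.2 (Nat.xor m (Nat.land m r.1)))
  else r

/-- All extensions of a partial assignment to the subcube `v j = b` with at most 24 edges there. -/
def complete (j b inn out : ℕ) : List (ℕ × ℕ) :=
  let m := q5Mask j b
  let live := (q5Faces j b).map fun f =>
    f.seeds.filter fun s => disjoint s.1 out && disjoint s.2 inn
  (pairsWith live fun l l' => l.flatMap fun s => l'.flatMap fun s' =>
    solveFrom (q5Squares j b) m 24 (Nat.lor inn (Nat.lor s.1 s'.1))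
      (Nat.lor out (Nat.lor s.2 s'.2))).map (close m)

/-- Completes halves in the given directions, of which `skips` may fail to have a half with 24
edges; then refutes the result with a budget of 59 edges. -/
def go : List ℕ → ℕ → ℕ → ℕ → Bool
  | [], _, inn, out => (solveFrom q6Squares q6Mask 59 inn out).isEmpty
  | d :: ds, s, inn, out =>
    (match s with
      | 0 => true
      | s + 1 => go ds s inn out) &&
    ([0, 1].all fun b => (complete d b inn out).all fun r => go ds s r.1 r.2)

/-- Sparse directions come first; soundness uses only that this is a permutation of the five
directions. -/
def dirOrder (r : ℕ × ℕ) : List ℕ :=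
  ([1, 2, 3, 4, 5].filter fun d => Nat.ble (dirPop r d) 4) ++
    ([1, 2, 3, 4, 5].filter fun d => !Nat.ble (dirPop r d) 4)

/-- Eight edges in one direction contradict `IsSparse.dir`; the single skip granted to `go`
corresponds to the exceptional direction of `IsSparse.halves`. -/
def leafRefuted (r : ℕ × ℕ) : Bool :=
  ([1, 2, 3, 4, 5].any fun d => Nat.ble 8 (dirPop r d)) ||
    go (dirOrder r) 1 (close (q5Mask 0 0) r).1 (close (q5Mask 0 0) r).2

/-- Six of the leaves at a time, which bounds the memory that the checks take. -/
def leafBlock (k : ℕ) : List (ℕ × ℕ) := ((exactLeaves ⟨0, 0, 2, 0⟩).drop k).take 6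

set_option maxRecDepth 100000 in
theorem leafBlock_0_refuted : (leafBlock 0).all leafRefuted = true := by decide +kernel

set_option maxRecDepth 100000 in
theorem leafBlock_6_refuted : (leafBlock 6).all leafRefuted = true := by decide +kernel

set_option maxRecDepth 100000 in
theorem leafBlock_12_refuted : (leafBlock 12).all leafRefuted = true := by decide +kernel

set_option maxRecDepth 100000 in
theorem leafBlock_18_refuted : (leafBlock 18).all leafRefuted = true := by decide +kernel

set_option maxRecDepth 100000 in
theorem leafBlock_24_refuted : (leafBlock 24).all leafRefuted = true := by decide +kernel

set_option maxRecDepth 100000 in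
theorem exactLeaves_drop : ((exactLeaves ⟨0, 0, 2, 0⟩).drop 30).all leafRefuted = true := by
  decide +kernel

theorem all_drop {α : Type*} {p : α → Bool} {l : List α} (k n : ℕ)
    (h : ((l.drop k).take n).all p = true) (h' : (l.drop (k + n)).all p = true) :
    (l.drop k).all p = true := by
  rw [← List.take_append_drop n (l.drop k), List.all_append, List.drop_drop, h, h']
  rfl

theorem leaves_refuted : (exactLeaves ⟨0, 0, 2, 0⟩).all leafRefuted = true := by
  rw [← List.drop_zero (l := exactLeaves ⟨0, 0, 2, 0⟩)]
  exact all_drop 0 6 leafBlock_0_refuted (all_drop 6 6 leafBlock_6_refuted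
    (all_drop 12 6 leafBlock_12_refuted (all_drop 18 6 leafBlock_18_refuted
      (all_drop 24 6 leafBlock_24_refuted exactLeaves_drop))))

theorem mem_pairsWith {ι α β : Type} (g : ι → α) (k : α → α → List β) {l : List ι} {x y : ι}
    (hx : x ∈ l) (hy : y ∈ l) (hxy : x ≠ y) :
    (∀ r ∈ k (g x) (g y), r ∈ pairsWith (l.map g) k) ∨
      ∀ r ∈ k (g y) (g x), r ∈ pairsWith (l.map g) k := by
  induction l with
  | nil => cases hx
  | cons a l ih =>
    have hcons : pairsWith ((a :: l).map g) k =
      (l.map g).flatMap (k (g a)) ++ pairsWith (l.map g) k := rfl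
    have hleft : ∀ z ∈ l, ∀ r ∈ k (g a) (g z), r ∈ pairsWith ((a :: l).map g) k := by
      intro z hz r hr
      rw [hcons, List.mem_append, List.mem_flatMap]
      exact Or.inl ⟨_, List.mem_map_of_mem hz, hr⟩
    rw [List.mem_cons] at hx hy
    rcases hx with rfl | hx
    · rcases hy with rfl | hy
      · exact absurd rfl hxy
      · exact Or.inl (hleft y hy)
    · rcases hy with rfl | hy
      · exact Or.inr (hleft x hx)
      · rw [hcons]
        exact (ih hx hy).imp (fun h r hr => List.mem_append_right _ (h r hr))
          fun h r hr => List.mem_append_right _ (h r hr)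

theorem agrees_close {P : ℕ → Bool} {m : ℕ} (hm : m < 2 ^ 384) (hb : load P m ≤ 24) {r : ℕ × ℕ}
    (h : Agrees P r.1 r.2) : Agrees P (close m r).1 (close m r).2 := by
  unfold close
  cases hp : Nat.ble 24 (pop 400 (Nat.land r.1 m)) with
  | false => exact h
  | true =>
    refine ⟨h.1, fun e he => ?_⟩
    have he' : (r.2.lor (m ^^^ m.land r.1)).testBit e = true := he
    rw [testBit_lor] at he'
    rcases he' with he' | he'
    · exact h.2 e he'
    · have h1 : m.testBit e = true ∧ ¬ r.1.testBit e = true := by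
        rw [Nat.testBit_xor] at he'
        change (m.testBit e ^^ (m &&& r.1).testBit e) = true at he'
        rw [Nat.testBit_and] at he'
        revert he'
        cases m.testBit e <;> cases r.1.testBit e <;> simp
      exact Agrees.of_le_pop hm h.1 hb (Nat.le_of_ble_eq_true hp) e
        (lt_of_testBit hm h1.1) h1.1 h1.2

theorem mem_q5Faces : ∀ (j : Fin 6) (b : Bool) (e : Fin 6) (c : Bool), e ≠ j →
    mkFace j b e c ∈ q5Faces j b.toNat := by
  intro j b e c h
  have h' : Nat.beq (e : ℕ) j = false := by
    rw [← Bool.not_eq_true]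
    exact fun h' => h (Fin.ext (Nat.eq_of_beq_eq_true h'))
  refine List.mem_flatMap.2 ⟨e, ?_, ?_⟩
  · clear h h'
    revert e
    decide
  · rw [h']
    cases c <;> simp [mkFace]

theorem mkFace_injective {j : Fin 6} {b : Bool} {x y : Fin 6 × Bool} (h : x ≠ y) :
    mkFace j b x.1 x.2 ≠ mkFace j b y.1 y.2 := by
  intro h'
  simp only [mkFace, Face.mk.injEq, true_and] at h'
  refine h (Prod.ext (Fin.ext h'.1) ?_)
  have := h'.2
  revert this
  cases x.2 <;> cases y.2 <;> simp

theorem Agrees.symm_disjoint {P : ℕ → Bool} {a b : ℕ} (h : Agrees P a b) :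
    SquareFree.disjoint b a = true := by
  rw [disjoint_iff]
  intro e h1 h2
  exact (disjoint_iff a b).1 h.disjoint e h2 h1

/-- In a half with at most 24 edges, two faces have at most nine edges and hence at most eight.
Their patterns therefore determine them fully and can seed the search. -/
theorem exists_mem_complete {F : Vertex → Fin 6 → Bool} (hF : IsHitting F) {j : Fin 6} {b : Bool}
    (h24 : cnt F (w5 j b) ≤ 24) {inn out : ℕ} (h : Agrees (code F) inn out) :
    ∃ r ∈ complete j b.toNat inn out, Agrees (code F) r.1 r.2 := by
  have hl : load (code F) (q5Mask j b.toNat) ≤ 24 := (load_q5Mask F j b).trans_le h24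
  obtain ⟨x, y, hx, hy, hxy, hx9, hy9⟩ := exists_two_faces hF h24
  have key : ∀ z : Fin 6 × Bool, z.1 ≠ j → cnt F (w4 j b z.1 z.2) ≤ 9 →
      ∃ s ∈ (mkFace j b z.1 z.2).seeds.filter fun s => disjoint s.1 out && disjoint s.2 inn,
        Agrees (code F) s.1 s.2 := by
    intro z hz h9
    obtain ⟨s, hs, ha⟩ := exists_seed hF hz (cnt_w4_le hF h24 hz h9)
    have h1 : Agrees (code F) s.1 out := ⟨ha.1, h.2⟩
    have h2 : Agrees (code F) inn s.2 := ⟨h.1, ha.2⟩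
    refine ⟨s, List.mem_filter.2 ⟨hs, ?_⟩, ha⟩
    rw [h1.disjoint, h2.symm_disjoint]
    rfl
  have solved : ∀ s s' : ℕ × ℕ, Agrees (code F) s.1 s.2 → Agrees (code F) s'.1 s'.2 →
      ∃ r ∈ solveFrom (q5Squares j b.toNat) (q5Mask j b.toNat) 24 (Nat.lor inn (Nat.lor s.1 s'.1))
        (Nat.lor out (Nat.lor s.2 s'.2)), Agrees (code F) r.1 r.2 := fun s s' ha ha' =>
    exists_mem_solveFrom (q5Mask_lt j b) (covered_of_mem_squares hF (q5Squares_mask j b))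
      (h.lor (ha.lor ha')) hl
  obtain ⟨s, hs, ha⟩ := key x hx hx9
  obtain ⟨t, ht, ha'⟩ := key y hy hy9
  rcases mem_pairsWith
    (fun f : Face => f.seeds.filter fun s => disjoint s.1 out && disjoint s.2 inn)
    (fun l l' => l.flatMap fun s => l'.flatMap fun s' =>
      solveFrom (q5Squares j b.toNat) (q5Mask j b.toNat) 24 (Nat.lor inn (Nat.lor s.1 s'.1))
        (Nat.lor out (Nat.lor s.2 s'.2)))
    (mem_q5Faces j b x.1 x.2 hx) (mem_q5Faces j b y.1 y.2 hy) (mkFace_injective hxy) with hm | hm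
  · obtain ⟨r, hr, har⟩ := solved s t ha ha'
    exact ⟨_, List.mem_map.2 ⟨r, hm r (List.mem_flatMap.2 ⟨s, hs, List.mem_flatMap.2 ⟨t, ht, hr⟩⟩),
      rfl⟩, agrees_close (q5Mask_lt j b) hl har⟩
  · obtain ⟨r, hr, har⟩ := solved t s ha' ha
    exact ⟨_, List.mem_map.2 ⟨r, hm r (List.mem_flatMap.2 ⟨t, ht, List.mem_flatMap.2 ⟨s, hs, hr⟩⟩),
      rfl⟩, agrees_close (q5Mask_lt j b) hl har⟩

/-- Both halves in direction `d` have more than 24 edges. -/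
def heavy (F : Vertex → Fin 6 → Bool) (d : ℕ) : Bool :=
  decide (∀ b, 24 < cnt F (w5 (Fin.ofNat 6 d) b))

/-- An actual hitting set of at most 59 edges keeps one branch alive: a heavy direction consumes a
skip, any other one has a light half whose completion agrees with the set, and the final search then
has a leaf. -/
theorem not_go {F : Vertex → Fin 6 → Bool} (hF : IsHitting F) (h59 : cnt F w6 ≤ 59) {ds : List ℕ}
    (hds : ∀ d ∈ ds, d < 6) {s : ℕ} (hs : ds.countP (heavy F) ≤ s) {inn out : ℕ}
    (h : Agrees (code F) inn out) : go ds s inn out = false := by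
  induction ds generalizing s inn out with
  | nil =>
    obtain ⟨r, hr, -⟩ := exists_mem_solveFrom (m := q6Mask) (by decide +kernel)
      (covered_of_mem_squares hF q6Squares_mask) h ((load_q6Mask F).trans_le h59)
    change (solveFrom q6Squares q6Mask 59 inn out).isEmpty = false
    rw [List.isEmpty_eq_false_iff_exists_mem]
    exact ⟨r, hr⟩
  | cons d ds ih =>
    have hds' : ∀ e ∈ ds, e < 6 := fun e he => hds e (List.mem_cons_of_mem _ he)
    rw [List.countP_cons] at hs
    by_cases hd : heavy F d = true
    · rw [if_pos hd] at hs
      obtain ⟨t, rfl⟩ : ∃ t, s = t + 1 := ⟨s - 1, by omega⟩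
      rw [go.eq_def]
      dsimp only
      rw [ih hds' (by omega) h, Bool.false_and]
    · have hd' := hd
      unfold heavy at hd'
      rw [decide_eq_true_iff] at hd'
      push Not at hd'
      obtain ⟨b, hb⟩ := hd'
      obtain ⟨r, hr, ha⟩ := exists_mem_complete hF hb h
      have hd6 : ((Fin.ofNat 6 d : Fin 6) : ℕ) = d :=
        Nat.mod_eq_of_lt (hds d List.mem_cons_self)
      rw [hd6] at hr
      rw [go.eq_def]
      dsimp only
      rw [Bool.and_eq_false_iff]
      refine Or.inr ?_
      rw [List.all_eq_false]
      refine ⟨b.toNat, by cases b <;> simp, ?_⟩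
      rw [Bool.not_eq_true, List.all_eq_false]
      refine ⟨r, hr, ?_⟩
      rw [ih hds' ((Nat.le_add_right _ _).trans hs) ha]
      decide

theorem dirOrder_perm (r : ℕ × ℕ) : (dirOrder r).Perm [1, 2, 3, 4, 5] :=
  List.filter_append_perm _ _

theorem false_of_leaf {F : Vertex → Fin 6 → Bool} (hF : IsHitting F) (h59 : cnt F w6 ≤ 59)
    (h24 : cnt F (w5 0 false) ≤ 24) (h7 : ∀ d, d ≠ 0 → cnt F (wd5 0 false d) ≤ 7)
    (hh : [1, 2, 3, 4, 5].countP (heavy F) ≤ 1) {r : ℕ × ℕ} (hr : r ∈ exactLeaves ⟨0, 0, 2, 0⟩)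
    (h : Agrees (code F) r.1 r.2) : False := by
  have hc := List.all_eq_true.1 leaves_refuted r hr
  unfold leafRefuted at hc
  have ha : Agrees (code F) (close (q5Mask 0 0) r).1 (close (q5Mask 0 0) r).2 :=
    agrees_close (q5Mask_lt 0 false) ((load_q5Mask F 0 false).trans_le h24) h
  rw [not_go hF h59 (fun d hd => ?_) (((dirOrder_perm r).countP_eq _).trans_le hh) ha,
    Bool.or_false,
    List.any_eq_true] at hc
  · obtain ⟨d, hd, h8⟩ := hc
    simp only [List.mem_cons, List.not_mem_nil, or_false] at hd
    have hd' : d < 6 ∧ d ≠ 0 := by omega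
    have h1 := dirPop_le h ⟨d, hd'.1⟩ fun h' => hd'.2 (congrArg Fin.val h')
    have h2 := h7 ⟨d, hd'.1⟩ fun h' => hd'.2 (congrArg Fin.val h')
    have h3 := Nat.le_of_ble_eq_true h8
    simp only at h1
    omega
  · rw [(dirOrder_perm r).mem_iff] at hd
    simp only [List.mem_cons, List.not_mem_nil, or_false] at hd
    omega

/-! ### The lower bound for hitting sets -/

/-- The subcube `v 0 = false` has at most 24 edges, at most seven in each direction, and all
directions but one have a half with at most 24 edges. -/
structure IsSparse (F : Vertex → Fin 6 → Bool) : Prop where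
  cube : cnt F w6 ≤ 59
  half : cnt F (w5 0 false) ≤ 24
  dir : ∀ d, d ≠ 0 → cnt F (wd5 0 false d) ≤ 7
  halves : ∃ a, ∀ d, d ≠ 0 → d ≠ a → ∃ b, cnt F (w5 d b) ≤ 24

/-- The negation is used because `Moved` pulls properties back from the moved set, while sparsity
has to be carried forward to it. -/
theorem invariant_not_isSparse : Invariant fun F => ¬ IsSparse F := by
  refine fun F hF => ⟨fun t ht h hs => h ⟨?_, ?_, fun d hd => ?_, ?_⟩,
    fun a b ha hb h hs => h ⟨?_, ?_, fun d hd => ?_, ?_⟩⟩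
  · rw [cnt_refl_w6 hF]
    exact hs.cube
  · rw [cnt_refl_w5 hF, ht]
    exact hs.half
  · rw [cnt_refl_wd5 hF, ht]
    exact hs.dir d hd
  · obtain ⟨a, ha⟩ := hs.halves
    refine ⟨a, fun d hd hda => ?_⟩
    obtain ⟨b, hb⟩ := ha d hd hda
    refine ⟨b ^^ t d, ?_⟩
    rw [cnt_refl_w5 hF, Bool.xor_assoc, Bool.xor_self, Bool.xor_false]
    exact hb
  all_goals
    have h0 : Equiv.swap a b 0 = 0 := Equiv.swap_apply_of_ne_of_ne (Ne.symm ha) (Ne.symm hb)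
    have hne : ∀ d, d ≠ 0 → Equiv.swap a b d ≠ 0 := fun d hd h' =>
      hd (by rw [Equiv.swap_apply_eq_iff, h0] at h'; exact h')
  · rw [cnt_perm_w6 hF]
    exact hs.cube
  · rw [cnt_perm_w5 hF, Equiv.symm_swap, h0]
    exact hs.half
  · rw [cnt_perm_wd5 hF, Equiv.symm_swap, h0]
    exact hs.dir _ (hne d hd)
  · obtain ⟨k, hk⟩ := hs.halves
    refine ⟨Equiv.swap a b k, fun d hd hda => ?_⟩
    simp only [cnt_perm_w5 hF, Equiv.symm_swap]
    refine hk _ (hne d hd) fun h' => hda ?_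
    rw [← h', Equiv.swap_apply_self]

theorem countP_heavy {F : Vertex → Fin 6 → Bool} {a : Fin 6}
    (ha : ∀ d, d ≠ 0 → d ≠ a → ∃ b, cnt F (w5 d b) ≤ 24) :
    [1, 2, 3, 4, 5].countP (heavy F) ≤ 1 := by
  have h1 : [1, 2, 3, 4, 5].countP (heavy F) ≤ [1, 2, 3, 4, 5].countP (· == (a : ℕ)) := by
    refine List.countP_mono_left fun d hd hh => ?_
    simp only [List.mem_cons, List.not_mem_nil, or_false] at hd
    by_contra hne
    unfold heavy at hh
    rw [decide_eq_true_iff] at hh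
    have hd6 : ((Fin.ofNat 6 d : Fin 6) : ℕ) = d := Nat.mod_eq_of_lt (by omega)
    obtain ⟨b, hb⟩ := ha (Fin.ofNat 6 d) (fun h => by
      have := congrArg Fin.val h
      rw [hd6] at this
      simp only [Fin.val_zero] at this
      omega) fun h => hne (by rw [← h, hd6]; simp)
    exact absurd (hh b) (by omega)
  refine h1.trans ?_
  change List.count _ _ ≤ 1
  exact List.nodup_iff_count_le_one.1 (by decide) _

theorem not_isSparse {F : Vertex → Fin 6 → Bool} (hF : IsHitting F) : ¬ IsSparse F := by
  intro hs
  obtain ⟨x, y, hx, hy, hxy, hx9, hy9⟩ := exists_two_faces hF hs.half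
  have hx8 := cnt_w4_le hF hs.half hx hx9
  have hy8 := cnt_w4_le hF hs.half hy hy9
  -- Two opposite faces with at most eight edges each would leave at least `24 - 16 = 8` edges in
  -- the direction between them, against `IsSparse.dir`.
  have hne : y.1 ≠ x.1 := by
    intro h
    have h1 := cnt_w5_eq F hx false
    have h2 := cnt_w5_eq_of_le hF hs.half
    have h3 := hs.dir _ hx
    have h4 : y.2 = !x.2 := by
      by_contra h'
      refine hxy (Prod.ext h.symm ?_)
      revert h'
      cases x.2 <;> cases y.2 <;> simp
    rw [h, h4] at hy8
    cases hb : x.2 <;> rw [hb] at hx8 hy8 <;> simp only [Bool.not_true, Bool.not_false] at hy8 <;>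
      omega
  obtain ⟨G, hG, hm, k1, k2, k3, hp⟩ := exists_cross hF hx hy hne y.2 hx9
  refine hm _ invariant_not_isSparse (fun hs' => ?_) hs
  obtain ⟨r, hr, ha⟩ := exists_mem_exactLeaves hG hs'.half (by omega) hp (e := 2) (by decide)
    (c := false) (by omega)
  obtain ⟨a, hh⟩ := hs'.halves
  exact false_of_leaf hG hs'.cube hs'.half hs'.dir (countP_heavy hh) hr ha

theorem exists_maximal {F : Vertex → Fin 6 → Bool} (hF : IsHitting F) : ∃ G, IsHitting G ∧
    cnt G w6 = cnt F w6 ∧ (∀ d, cnt G (wd d) ≤ cnt G (wd 0)) ∧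
      cnt G (w5 0 false) ≤ cnt G (w5 0 true) := by
  obtain ⟨j, -, hj⟩ := Finset.exists_max_image Finset.univ (fun d => cnt F (wd d))
    ⟨0, Finset.mem_univ _⟩
  obtain ⟨b, hb⟩ : ∃ b, cnt F (w5 j b) ≤ cnt F (w5 j !b) := by
    rcases le_total (cnt F (w5 j false)) (cnt F (w5 j true)) with h | h
    · exact ⟨false, h⟩
    · exact ⟨true, h⟩
  refine ⟨onSub F j b, hF.onSub j b, ?_, fun d => ?_, ?_⟩ <;> unfold onSub
  · rw [cnt_perm_w6 (hF.refl _), cnt_refl_w6 hF]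
  · rw [cnt_perm_wd (hF.refl _), cnt_perm_wd (hF.refl _), cnt_refl_wd hF, cnt_refl_wd hF,
      Equiv.symm_swap, Equiv.swap_apply_left]
    exact hj _ (Finset.mem_univ _)
  · rw [cnt_perm_w5 (hF.refl _), cnt_perm_w5 (hF.refl _), cnt_refl_w5 hF, cnt_refl_w5 hF,
      Equiv.symm_swap, Equiv.swap_apply_left, Bool.false_xor, Bool.true_xor]
    exact hb

theorem sixty_le {F : Vertex → Fin 6 → Bool} (hF : IsHitting F) : 60 ≤ cnt F w6 := by
  by_contra hlt
  obtain ⟨G, hG, hN, hmax, hhalf⟩ := exists_maximal hF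
  have hw : ∀ d, 24 ≤ cnt G (w5 d false) ∧ 24 ≤ cnt G (w5 d true) ∧
      cnt G w6 = cnt G (w5 d false) + cnt G (w5 d true) + cnt G (wd d) := fun d =>
    ⟨le_cnt_w5 hG d false, le_cnt_w5 hG d true, cnt_w6_eq G d⟩
  have hsum := cnt_w6_eq_sum G
  rw [← Finset.add_sum_erase _ _ (Finset.mem_univ 0), sum_erase_zero] at hsum
  -- The two halves take at least 48 of at most 59 edges.
  have hle : ∀ d, cnt G (wd d) ≤ 11 := fun d => by have := hw d; omega
  have l0 := hw 0
  have l1 := hw 1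
  have l2 := hw 2
  have l3 := hw 3
  have l4 := hw 4
  have l5 := hw 5
  -- Direction 0 has at least a sixth of all edges, but at most the total minus 48; this fails for
  -- totals up to 57.
  have h58 : 58 ≤ cnt G w6 := by omega
  have m1 := hmax 1
  have m2 := hmax 2
  have m3 := hmax 3
  have m4 := hmax 4
  have m5 := hmax 5
  -- Eleven edges in direction `d` force eleven in direction 0, hence two halves of exactly 24. Both
  -- have evenly many edges in direction `d`, but 11 is odd.
  have h10 : ∀ d, d ≠ 0 → cnt G (wd d) ≤ 10 := by
    intro d hd
    by_contra h11
    have := hmax d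
    have e1 := even_cnt_wd5 hG (j := 0) (b := false) (by omega) hd
    have e2 := even_cnt_wd5 hG (j := 0) (b := true) (by omega) hd
    have := cnt_wd_eq G hd
    have := hle d
    obtain ⟨a, ha⟩ := e1
    obtain ⟨b, hb⟩ := e2
    omega
  have t1 := h10 1 (by decide)
  have t2 := h10 2 (by decide)
  have t3 := h10 3 (by decide)
  have t4 := h10 4 (by decide)
  have t5 := h10 5 (by decide)
  refine not_isSparse hG ⟨by omega, by omega, fun d hd => ?_, ?_⟩
  -- With eight or more edges of direction `d` in the light half, the other half has at most two,
  -- hence at least `32 - 6 = 26` edges in all; together with 24 and the at least 10 edges in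
  -- direction 0 this makes 60.
  · obtain ⟨a, ha⟩ := even_cnt_wd5 hG (j := 0) (b := false) (by omega) hd
    have := le_cnt_w5_add hG hd true
    have := cnt_wd_eq G hd
    have := h10 d hd
    omega
  · by_contra hno
    push Not at hno
    -- A direction with both halves above 24 has at most `59 - 50 = 9` edges, and at most 8 if
    -- direction 0 has eleven, since parity then applies to both halves. Two such directions make
    -- the sum over all directions fall short of the total.
    have hheavy : ∀ d, d ≠ 0 → (∀ b, 24 < cnt G (w5 d b)) →
        cnt G (wd d) + 50 ≤ cnt G w6 ∧ (cnt G (wd 0) = 11 → cnt G (wd d) ≤ 8) := by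
      intro d hd hb
      have := hw d
      have := hb false
      have := hb true
      refine ⟨by omega, fun h => ?_⟩
      obtain ⟨a, ha⟩ := even_cnt_wd5 hG (j := 0) (b := false) (by omega) hd
      obtain ⟨b, hb⟩ := even_cnt_wd5 hG (j := 0) (b := true) (by omega) hd
      have := cnt_wd_eq G hd
      omega
    obtain ⟨d, hd, -, hdb⟩ := hno 0
    obtain ⟨e, he, hed, heb⟩ := hno d
    have q1 := hheavy d hd hdb
    have q2 := hheavy e he heb
    have hle0 := hle 0
    have hm : d ∈ Finset.univ.erase (0 : Fin 6) := Finset.mem_erase.2 ⟨hd, Finset.mem_univ _⟩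
    have hm' : e ∈ (Finset.univ.erase (0 : Fin 6)).erase d :=
      Finset.mem_erase.2 ⟨hed, Finset.mem_erase.2 ⟨he, Finset.mem_univ _⟩⟩
    have hrest := Finset.sum_le_card_nsmul (((Finset.univ.erase (0 : Fin 6)).erase d).erase e)
      (fun k => cnt G (wd k)) 10 fun k hk => by
        simp only [Finset.mem_erase] at hk
        exact h10 k hk.2.2.1
    rw [Finset.card_erase_of_mem hm', Finset.card_erase_of_mem hm,
      Finset.card_erase_of_mem (Finset.mem_univ _), Finset.card_univ, Fintype.card_fin,
      smul_eq_mul] at hrest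
    have hsum' := cnt_w6_eq_sum G
    rw [← Finset.add_sum_erase _ _ (Finset.mem_univ 0), ← Finset.add_sum_erase _ _ hm,
      ← Finset.add_sum_erase _ _ hm'] at hsum'
    clear hsum m1 m2 m3 m4 m5 t1 t2 t3 t4 t5 l1 l2 l3 l4 l5
    omega

/-! ### Four-cycles of a graph and the integer program -/

section graph

variable {V : Type*} {G : SimpleGraph V}

theorem cycleGraph_four_isContained {G' : SimpleGraph V} {a b c d : V} (hab : G'.Adj a b)
    (hbc : G'.Adj b c) (hcd : G'.Adj c d) (hda : G'.Adj d a) (hac : a ≠ c) (hbd : b ≠ d) :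
    (SimpleGraph.cycleGraph 4).IsContained G' := by
  have h1 := hab.ne
  have h2 := hbc.ne
  have h3 := hcd.ne
  have h4 := hda.ne
  refine ⟨⟨⟨![a, b, c, d], ?_⟩, ?_⟩⟩
  · intro u v
    rw [SimpleGraph.cycleGraph_adj]
    fin_cases u <;> fin_cases v <;> simp [hab, hbc, hcd, hda, hab.symm, hbc.symm, hcd.symm,
      hda.symm]
    all_goals exact fun h => absurd h (by decide)
  · intro u v
    change ![a, b, c, d] u = ![a, b, c, d] v → u = v
    fin_cases u <;> fin_cases v <;>
      simp [h1, h2, h3, h4, hac, hbd, h1.symm, h2.symm, h3.symm,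
      h4.symm, hac.symm, hbd.symm]

variable [DecidableEq V]

theorem card_of_mem_fourCycles {C : Finset G.edgeSet} (hC : C ∈ fourCycles G) : C.card = 4 := by
  obtain ⟨a, b, c, d, hab, hbc, hcd, hda, hac, hbd, rfl⟩ := hC
  have h1 := hab.ne
  have h2 := hbc.ne
  have h3 := hcd.ne
  have h4 := hda.ne
  rw [Finset.card_insert_of_notMem, Finset.card_insert_of_notMem, Finset.card_insert_of_notMem,
    Finset.card_singleton]
  all_goals
    simp only [Finset.mem_insert, Finset.mem_singleton]
    grind

theorem sum_le_three_iff {C : Finset G.edgeSet} (hC : C ∈ fourCycles G) {x : G.edgeSet → ℤ}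
    (hx : ∀ e, x e = 0 ∨ x e = 1) : ∑ e ∈ C, x e ≤ 3 ↔ ∃ e ∈ C, x e = 0 := by
  constructor
  · intro h
    by_contra hno
    push Not at hno
    rw [Finset.sum_congr rfl fun e he => (hx e).resolve_left (hno e he), Finset.sum_const,
      card_of_mem_fourCycles hC] at h
    norm_num at h
  · rintro ⟨e, he, h0⟩
    rw [← Finset.add_sum_erase _ _ he, h0, zero_add]
    refine (Finset.sum_le_card_nsmul _ _ 1 fun e _ => ?_).trans ?_
    · rcases hx e with h | h <;> simp [h]
    · rw [Finset.card_erase_of_mem he, card_of_mem_fourCycles hC]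
      norm_num

variable [Fintype G.edgeSet]

theorem exists_feasible_of_free {G' : SimpleGraph V} (hle : G' ≤ G)
    (hfree : (SimpleGraph.cycleGraph 4).Free G') :
    ∃ x : G.edgeSet → ℤ, IsFeasibleILP G x ∧ ∑ e, x e = G'.edgeSet.ncard := by
  classical
  let x : G.edgeSet → ℤ := fun e => if (e : Sym2 V) ∈ G'.edgeSet then 1 else 0
  have hx : ∀ e, x e = 0 ∨ x e = 1 := fun e => by
    simp only [x]
    split_ifs <;> simp
  refine ⟨x, ⟨hx, fun C hC => ?_⟩, ?_⟩
  · rw [sum_le_three_iff hC hx]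
    by_contra hno
    push Not at hno
    have hadj : ∀ e ∈ C, (e : Sym2 V) ∈ G'.edgeSet := fun e he => by
      by_contra h
      exact hno e he (if_neg h)
    obtain ⟨a, b, c, d, hab, hbc, hcd, hda, hac, hbd, rfl⟩ := hC
    simp only [Finset.mem_insert, Finset.mem_singleton, forall_eq_or_imp, forall_eq,
      SimpleGraph.mem_edgeSet] at hadj
    exact hfree (cycleGraph_four_isContained hadj.1 hadj.2.1 hadj.2.2.1 hadj.2.2.2 hac hbd)
  · have h1 : G'.edgeSet = (Finset.univ.filter fun e : G.edgeSet =>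
        (e : Sym2 V) ∈ G'.edgeSet).map (Function.Embedding.subtype _) := by
      ext e
      simp only [Finset.coe_map, Finset.coe_filter, Finset.mem_univ, true_and, Set.mem_image,
        Set.mem_ofPred_eq, Function.Embedding.coe_subtype]
      constructor
      · intro he
        exact ⟨⟨e, SimpleGraph.edgeSet_mono hle he⟩, he, rfl⟩
      · rintro ⟨e, he, rfl⟩
        exact he
    simp only [x]
    rw [Finset.sum_boole, (congrArg Set.ncard h1).trans (Set.ncard_coe_finset _), Finset.card_map]

theorem exists_free_of_feasible {x : G.edgeSet → ℤ} (hx : IsFeasibleILP G x) :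
    ∃ G' : SimpleGraph V, G' ≤ G ∧ (SimpleGraph.cycleGraph 4).Free G' ∧
      (G'.edgeSet.ncard : ℤ) = ∑ e, x e := by
  classical
  let S : Finset (Sym2 V) := (Finset.univ.filter fun e : G.edgeSet => x e = 1).map
    (Function.Embedding.subtype _)
  have hS : ∀ e : Sym2 V, e ∈ S ↔ ∃ h : e ∈ G.edgeSet, x ⟨e, h⟩ = 1 := by
    intro e
    simp [S]
  have hset : (SimpleGraph.fromEdgeSet (S : Set (Sym2 V))).edgeSet = S := by
    rw [SimpleGraph.edgeSet_fromEdgeSet]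
    refine sdiff_eq_left.2 (Set.disjoint_left.2 fun e he hd => ?_)
    obtain ⟨h, -⟩ := (hS e).1 he
    exact G.not_isDiag_of_mem_edgeSet h hd
  have hadj : ∀ a b, (SimpleGraph.fromEdgeSet (S : Set (Sym2 V))).Adj a b →
      ∃ h : G.Adj a b, x ⟨s(a, b), h⟩ = 1 := by
    intro a b h
    rw [← SimpleGraph.mem_edgeSet, hset] at h
    exact (hS _).1 h
  refine ⟨SimpleGraph.fromEdgeSet S, fun a b h => (hadj a b h).1, ?_, ?_⟩
  · rintro ⟨f⟩
    have hf : ∀ u v : Fin 4, (SimpleGraph.cycleGraph 4).Adj u v →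
        ∃ h : G.Adj (f u) (f v), x ⟨s(f u, f v), h⟩ = 1 := fun u v h =>
      hadj _ _ (f.toHom.map_adj h)
    obtain ⟨h01, x01⟩ := hf 0 1 (by rw [SimpleGraph.cycleGraph_adj]; decide)
    obtain ⟨h12, x12⟩ := hf 1 2 (by rw [SimpleGraph.cycleGraph_adj]; decide)
    obtain ⟨h23, x23⟩ := hf 2 3 (by rw [SimpleGraph.cycleGraph_adj]; decide)
    obtain ⟨h30, x30⟩ := hf 3 0 (by rw [SimpleGraph.cycleGraph_adj]; decide)
    have hC : ({⟨s(f 0, f 1), h01⟩, ⟨s(f 1, f 2), h12⟩, ⟨s(f 2, f 3), h23⟩,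
        ⟨s(f 3, f 0), h30⟩} : Finset G.edgeSet) ∈ fourCycles G :=
      ⟨f 0, f 1, f 2, f 3, h01, h12, h23, h30, fun h => absurd (f.injective h) (by decide),
        fun h => absurd (f.injective h) (by decide), rfl⟩
    obtain ⟨e, he, h0⟩ := (sum_le_three_iff hC hx.1).1 (hx.2 _ hC)
    simp only [Finset.mem_insert, Finset.mem_singleton] at he
    rcases he with rfl | rfl | rfl | rfl
    · rw [x01] at h0; norm_num at h0
    · rw [x12] at h0; norm_num at h0
    · rw [x23] at h0; norm_num at h0
    · rw [x30] at h0; norm_num at h0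
  · rw [hset, Set.ncard_coe_finset, Finset.card_map, ← Finset.sum_boole]
    refine Finset.sum_congr rfl fun e _ => ?_
    rcases hx.1 e with h | h <;> simp [h]

end graph

/-! ### Edges and four-cycles of the six-dimensional cube -/

theorem flip_self (v : Vertex) (i : Fin 6) : flip v i i = !v i := by
  rw [flip_apply, if_pos rfl]

theorem flip_of_ne (v : Vertex) {i j : Fin 6} (h : j ≠ i) : flip v i j = v j := by
  rw [flip_apply, if_neg h]

theorem flip_comm (v : Vertex) (i j : Fin 6) : flip (flip v i) j = flip (flip v j) i := by
  by_cases h : j = i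
  · rw [h]
  · unfold flip
    rw [Function.update_of_ne h, Function.update_of_ne (Ne.symm h),
      Function.update_comm (Ne.symm h)]

theorem flip_injective (v : Vertex) {i j : Fin 6} (h : flip v i = flip v j) : i = j := by
  by_contra hij
  have := congrFun h i
  rw [flip_self, flip_of_ne _ hij] at this
  simp at this

theorem adj_iff (u v : Vertex) : (hypercube 6).Adj u v ↔ ∃ i, v = flip u i := by
  change (Finset.univ.filter fun i => u i ≠ v i).card = 1 ↔ _
  rw [Finset.card_eq_one]
  refine exists_congr fun i => ?_
  rw [Finset.ext_iff, funext_iff]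
  refine forall_congr' fun k => ?_
  rw [flip_apply]
  simp only [Finset.mem_filter, Finset.mem_univ, true_and, Finset.mem_singleton]
  split_ifs with h
  · subst h
    cases u k <;> cases v k <;> simp
  · simp only [h, iff_false, not_not]
    exact eq_comm

theorem adj_flip (v : Vertex) (i : Fin 6) : (hypercube 6).Adj v (flip v i) :=
  (adj_iff _ _).2 ⟨i, rfl⟩

def edge (v : Vertex) (i : Fin 6) : (hypercube 6).edgeSet := ⟨s(v, flip v i), adj_flip v i⟩

theorem edge_flip (v : Vertex) (i : Fin 6) : edge (flip v i) i = edge v i := by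
  refine Subtype.ext ?_
  change s(flip v i, flip (flip v i) i) = s(v, flip v i)
  rw [flip_flip, Sym2.eq_swap]

theorem edge_injective {v w : Vertex} {i j : Fin 6} (hv : v i = false) (hw : w j = false)
    (h : edge v i = edge w j) : v = w ∧ i = j := by
  have h : s(v, flip v i) = s(w, flip w j) := congrArg Subtype.val h
  rw [Sym2.eq_iff] at h
  rcases h with ⟨rfl, h⟩ | ⟨h1, h2⟩
  · exact ⟨rfl, flip_injective v h⟩
  · exfalso
    have h3 : flip v i = flip v j := by rw [h2, h1, flip_flip]
    have h4 := flip_injective v h3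
    subst h4
    rw [h1, flip_self, hw] at hv
    cases hv

theorem edge_bijective : Function.Bijective
    fun p : {p : Fin 6 × Vertex // p.2 p.1 = false} => edge p.1.2 p.1.1 := by
  constructor
  · rintro ⟨⟨i, v⟩, hv⟩ ⟨⟨j, w⟩, hw⟩ h
    obtain ⟨h1, h2⟩ := edge_injective hv hw h
    simp only at h1 h2
    subst h1 h2
    rfl
  · rintro ⟨e, he⟩
    induction e with
    | _ u v =>
      obtain ⟨i, rfl⟩ := (adj_iff u v).1 he
      cases hu : u i with
      | false => exact ⟨⟨(i, u), hu⟩, rfl⟩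
      | true =>
        refine ⟨⟨(i, flip u i), ?_⟩, edge_flip u i⟩
        simp only
        rw [flip_self, hu]
        rfl

theorem sum_edges {M : Type*} [AddCommMonoid M] (x : (hypercube 6).edgeSet → M) :
    ∑ e, x e = ∑ i, ∑ v, if v i = false then x (edge v i) else 0 := by
  rw [← edge_bijective.sum_comp]
  rw [← Fintype.sum_prod_type' (f := fun i (v : Vertex) =>
    if v i = false then x (edge v i) else 0), ← Finset.sum_filter]
  exact (Finset.sum_subtype (Finset.univ.filter fun p : Fin 6 × Vertex => p.2 p.1 = false)
    (fun p => by simp) fun p => x (edge p.2 p.1)).symm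

theorem sum_low : ∑ i : Fin 6, ∑ v : Vertex, (if v i = false then 1 else 0) = 192 := by
  decide +kernel

theorem card_edges : Fintype.card (hypercube 6).edgeSet = 192 := by
  rw [← sum_low, ← Finset.card_univ, Finset.card_eq_sum_ones, sum_edges]

theorem cnt_w6 (F : Vertex → Fin 6 → Bool) : cnt F w6 =
    ∑ i, ∑ v, if v i = false then (if F v i = true then 1 else 0) else 0 :=
  sum_lowEdges fun v i => if F v i = true then 1 else 0

theorem sum_add_cnt {F : Vertex → Fin 6 → Bool} {x : (hypercube 6).edgeSet → ℤ}
    (h : ∀ v i, x (edge v i) = if F v i = true then 0 else 1) : ∑ e, x e + cnt F w6 = 192 := by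
  have hl : (192 : ℤ) = ∑ i : Fin 6, ∑ v : Vertex, (if v i = false then 1 else 0) := by
    exact_mod_cast sum_low.symm
  rw [sum_edges, cnt_w6, hl]
  push_cast
  rw [← Finset.sum_add_distrib]
  refine Finset.sum_congr rfl fun i _ => ?_
  rw [← Finset.sum_add_distrib]
  refine Finset.sum_congr rfl fun v _ => ?_
  rw [h]
  split_ifs <;> rfl

def square (v : Vertex) (i j : Fin 6) : Finset (hypercube 6).edgeSet :=
  {edge v i, edge (flip v i) j, edge (flip v j) i, edge v j}

theorem square_swap (v : Vertex) (i j : Fin 6) : square v i j = square v j i := by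
  unfold square
  ext e
  simp only [Finset.mem_insert, Finset.mem_singleton]
  tauto

theorem square_flip (v : Vertex) (i j : Fin 6) : square (flip v i) i j = square v i j := by
  unfold square
  rw [flip_flip, edge_flip, flip_comm, edge_flip]
  ext e
  simp only [Finset.mem_insert, Finset.mem_singleton]
  tauto

theorem square_mem (v : Vertex) {i j : Fin 6} (h : i ≠ j) :
    square v i j ∈ fourCycles (hypercube 6) := by
  refine ⟨v, flip v i, flip (flip v i) j, flip v j, adj_flip _ _, adj_flip _ _, ?_, ?_, ?_, ?_, ?_⟩
  · rw [flip_comm]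
    exact (adj_flip _ _).symm
  · exact (adj_flip _ _).symm
  · intro h'
    have := congrFun h' i
    rw [flip_of_ne _ h, flip_self] at this
    simp at this
  · exact fun h' => h (flip_injective v h')
  · unfold square edge
    simp only [flip_comm v i j, Sym2.eq_swap (a := flip (flip v j) i),
      Sym2.eq_swap (a := flip v j) (b := v)]

theorem exists_square {C : Finset (hypercube 6).edgeSet} (hC : C ∈ fourCycles (hypercube 6)) :
    ∃ v i j, i ≠ j ∧ C = square v i j := by
  obtain ⟨a, b, c, d, hab, hbc, hcd, hda, hac, hbd, rfl⟩ := hC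
  obtain ⟨i, rfl⟩ := (adj_iff _ _).1 hab
  obtain ⟨j, rfl⟩ := (adj_iff _ _).1 hbc
  obtain ⟨k, hk⟩ := (adj_iff _ _).1 hcd
  obtain ⟨l, hl⟩ := (adj_iff _ _).1 hda.symm
  have hij : i ≠ j := by
    rintro rfl
    exact hac (flip_flip a i).symm
  have hkj : k ≠ j := by
    rintro rfl
    rw [flip_flip] at hk
    exact hbd hk.symm
  -- Otherwise `d` still differs from `a` in both coordinates `i` and `j`, although it is a
  -- neighbour of `a`.
  have hk' : k = i := by
    by_contra hki
    have h1 := congrFun hk i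
    have h2 := congrFun hk j
    rw [hl, flip_of_ne _ (Ne.symm hki), flip_of_ne _ hij, flip_self] at h1
    rw [hl, flip_of_ne _ (Ne.symm hkj), flip_self, flip_of_ne _ (Ne.symm hij)] at h2
    have hli : i = l := by
      by_contra h
      rw [flip_of_ne _ h] at h1
      simp at h1
    have hlj : j = l := by
      by_contra h
      rw [flip_of_ne _ h] at h2
      simp at h2
    exact hij (hli.trans hlj.symm)
  subst hk'
  have hd : d = flip a j := by rw [hk, flip_comm, flip_flip]
  subst hd
  refine ⟨a, k, j, hij, ?_⟩
  unfold square edge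
  simp only [flip_comm a k j, Sym2.eq_swap (a := flip (flip a j) k),
    Sym2.eq_swap (a := flip a j) (b := a)]

def lowSquares : Finset (Vertex × Fin 6 × Fin 6) := Finset.univ.filter fun p =>
  p.1 p.2.1 = false ∧ p.1 p.2.2 = false ∧ p.2.1 < p.2.2

theorem card_lowSquares : lowSquares.card = 240 := by decide +kernel

-- Flipping coordinates `i` and `j` where needed moves the base corner to the lowest corner of the
-- same square; that corner together with `i < j` is a normal form.
set_option linter.constructorNameAsVariable false in
theorem fourCycles_eq : fourCycles (hypercube 6) =
    (fun p : Vertex × Fin 6 × Fin 6 => square p.1 p.2.1 p.2.2) '' lowSquares := by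
  have key : ∀ v i j, i < j → ∃ w, w i = false ∧ w j = false ∧ square v i j = square w i j := by
    have step : ∀ v i j, i ≠ j → ∃ w, w i = false ∧ w j = v j ∧ square v i j = square w i j := by
      intro v i j hij
      cases h : v i with
      | false => exact ⟨v, h, rfl, rfl⟩
      | true =>
        refine ⟨flip v i, ?_, flip_of_ne _ (Ne.symm hij), (square_flip v i j).symm⟩
        rw [flip_self, h]
        rfl
    intro v i j hij
    obtain ⟨w, h1, -, h2⟩ := step v i j hij.ne
    obtain ⟨u, h3, h4, h5⟩ := step w j i hij.ne'
    exact ⟨u, h4.trans h1, h3, by rw [h2, square_swap w, h5, square_swap u]⟩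
  ext C
  constructor
  · intro hC
    obtain ⟨v, i, j, hij, rfl⟩ := exists_square hC
    rcases lt_or_gt_of_ne hij with h | h
    · obtain ⟨w, h1, h2, h3⟩ := key v i j h
      exact ⟨(w, i, j), by simp [lowSquares, h1, h2, h], h3.symm⟩
    · obtain ⟨w, h1, h2, h3⟩ := key v j i h
      exact ⟨(w, j, i), by simp [lowSquares, h1, h2, h], by rw [square_swap v]; exact h3.symm⟩
  · rintro ⟨⟨v, i, j⟩, hp, rfl⟩
    simp only [lowSquares, Finset.coe_filter, Finset.mem_univ, true_and, Set.mem_ofPred_eq] at hp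
    exact square_mem v hp.2.2.ne

theorem mem_square {v w : Vertex} {i j k : Fin 6} (hij : i ≠ j) (hi : v i = false)
    (hj : v j = false) (hk : w k = false) (h : edge w k ∈ square v i j) :
    (k = i ∨ k = j) ∧ (w = v ∨ w i = true ∨ w j = true) := by
  simp only [square, Finset.mem_insert, Finset.mem_singleton] at h
  have hi' : flip v i j = false := by rw [flip_of_ne _ (Ne.symm hij), hj]
  have hj' : flip v j i = false := by rw [flip_of_ne _ hij, hi]
  rcases h with h | h | h | h
  · obtain ⟨rfl, rfl⟩ := edge_injective hk hi h
    exact ⟨Or.inl rfl, Or.inl rfl⟩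
  · obtain ⟨rfl, rfl⟩ := edge_injective hk hi' h
    exact ⟨Or.inr rfl, Or.inr (Or.inl (by rw [flip_self, hi]; rfl))⟩
  · obtain ⟨rfl, rfl⟩ := edge_injective hk hj' h
    exact ⟨Or.inl rfl, Or.inr (Or.inr (by rw [flip_self, hj]; rfl))⟩
  · obtain ⟨rfl, rfl⟩ := edge_injective hk hj h
    exact ⟨Or.inr rfl, Or.inl rfl⟩

-- The two edges at the lowest corner give the ordered pair of directions; among the lower ends of
-- edges of the square, only that corner has both coordinates false.
set_option linter.constructorNameAsVariable false in
theorem square_injOn : Set.InjOn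
    (fun p : Vertex × Fin 6 × Fin 6 => square p.1 p.2.1 p.2.2) lowSquares := by
  rintro ⟨v, i, j⟩ hp ⟨w, k, l⟩ hq h
  simp only [lowSquares, Finset.coe_filter, Finset.mem_univ, true_and, Set.mem_ofPred_eq] at hp hq h
  obtain ⟨hi, hj, hij⟩ := hp
  obtain ⟨hk, hl, hkl⟩ := hq
  have m1 : edge v i ∈ square w k l := by rw [← h]; simp [square]
  have m2 : edge v j ∈ square w k l := by rw [← h]; simp [square]
  obtain ⟨a1, a2⟩ := mem_square hkl.ne hk hl hi m1
  obtain ⟨b1, -⟩ := mem_square hkl.ne hk hl hj m2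
  have hik : i = k ∧ j = l := by omega
  obtain ⟨rfl, rfl⟩ := hik
  rw [hi, hj] at a2
  simp only [Bool.false_eq_true, or_false] at a2
  rw [a2]

theorem ncard_fourCycles : (fourCycles (hypercube 6)).ncard = 240 := by
  rw [fourCycles_eq, square_injOn.ncard_image, Set.ncard_coe_finset, card_lowSquares]

/-! ### The optimal value -/

theorem sum_le_of_isFeasible {x : (hypercube 6).edgeSet → ℤ} (hx : IsFeasibleILP (hypercube 6) x) :
    ∑ e, x e ≤ 132 := by
  -- The edges with value 0 form a hitting set, and `192 - 60 = 132`.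
  let F : Vertex → Fin 6 → Bool := fun v i => decide (x (edge v i) = 0)
  have hF : IsHitting F := by
    refine ⟨fun v i => by simp only [F, edge_flip], fun v i j hij => ?_⟩
    have hC := square_mem v hij
    obtain ⟨e, he, h0⟩ := (sum_le_three_iff hC hx.1).1 (hx.2 _ hC)
    simp only [square, Finset.mem_insert, Finset.mem_singleton] at he
    simp only [F, decide_eq_true_eq]
    rcases he with rfl | rfl | rfl | rfl <;> simp [h0]
  have h1 := sixty_le hF
  have h2 := sum_add_cnt (F := F) (x := x) fun v i => by
    simp only [F, decide_eq_true_eq]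
    split_ifs with h
    · exact h
    · exact (hx.1 _).resolve_left h
  omega

theorem exists_feasible_of_isHitting {F : Vertex → Fin 6 → Bool} (hF : IsHitting F) :
    ∃ x, IsFeasibleILP (hypercube 6) x ∧ ∑ e, x e + cnt F w6 = 192 := by
  let φ := Equiv.ofBijective _ edge_bijective
  let x : (hypercube 6).edgeSet → ℤ := fun e =>
    if F (φ.symm e).1.2 (φ.symm e).1.1 = true then 0 else 1
  have hlow : ∀ v i, v i = false → x (edge v i) = if F v i = true then 0 else 1 := by
    intro v i h
    have : φ.symm (edge v i) = ⟨(i, v), h⟩ := φ.symm_apply_apply ⟨(i, v), h⟩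
    simp only [x, this]
  have hedge : ∀ v i, x (edge v i) = if F v i = true then 0 else 1 := by
    intro v i
    cases h : v i with
    | false => exact hlow v i h
    | true =>
      rw [← edge_flip, hlow _ _ (by rw [flip_self, h]; rfl), hF.flip]
  have hx : ∀ e, x e = 0 ∨ x e = 1 := fun e => by
    simp only [x]
    split_ifs <;> simp
  refine ⟨x, ⟨hx, fun C hC => ?_⟩, sum_add_cnt hedge⟩
  rw [sum_le_three_iff hC hx]
  obtain ⟨v, i, j, hij, rfl⟩ := exists_square hC
  have hmem : ∀ w k, F w k = true → edge w k ∈ square v i j → ∃ e ∈ square v i j, x e = 0 :=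
    fun w k hw h => ⟨_, h, by rw [hedge, if_pos hw]⟩
  rcases hF.hit v i j hij with h | h | h | h <;> exact hmem _ _ h (by simp [square])

/-- A set of 60 edges meeting all four-cycles. -/
def witness (v : Vertex) (i : Fin 6) : Bool :=
  -- Six blocks of 64 digits, one per direction; an edge is recorded at both of its ends.
  Nat.testBit 0x812428418124284142a942a994529452525286862929101000889944661144aaa550550a5a0a0aa53c03003000c0c30c
    (64 * i + ∑ k : Fin 6, if v k = true then 2 ^ (k : ℕ) else 0)

theorem isHitting_witness : IsHitting witness :=
  ⟨by decide +kernel, by decide +kernel⟩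

theorem cnt_witness : cnt witness w6 = 60 := by decide +kernel

theorem isGreatest_ilp : IsGreatest {m : ℤ | ∃ x : (hypercube 6).edgeSet → ℤ,
    IsFeasibleILP (hypercube 6) x ∧ ∑ e, x e = m} 132 := by
  constructor
  · obtain ⟨x, hx, h⟩ := exists_feasible_of_isHitting isHitting_witness
    rw [cnt_witness] at h
    exact ⟨x, hx, by push_cast at h; omega⟩
  · rintro m ⟨x, hx, rfl⟩
    exact sum_le_of_isFeasible hx

theorem exists_free : ∃ G : SimpleGraph (Fin 6 → Bool), G ≤ hypercube 6 ∧
    (SimpleGraph.cycleGraph 4).Free G ∧ G.edgeSet.ncard = 132 := by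
  obtain ⟨x, hx, h⟩ := isGreatest_ilp.1
  obtain ⟨G, hle, hfree, hc⟩ := exists_free_of_feasible hx
  exact ⟨G, hle, hfree, by rw [h] at hc; exact_mod_cast hc⟩

theorem exIn_eq : exIn (hypercube 6) (SimpleGraph.cycleGraph 4) = 132 := by
  refine IsGreatest.csSup_eq ⟨exists_free, ?_⟩
  rintro m ⟨G, hle, hfree, rfl⟩
  obtain ⟨x, hx, h⟩ := exists_feasible_of_free hle hfree
  have := sum_le_of_isFeasible hx
  omega

end SquareFree

theorem mainTheorem2 :
    -- the program has 192 variables and 240 four-cycle constraints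
    Fintype.card (hypercube 6).edgeSet = 192 ∧
    (fourCycles (hypercube 6)).ncard = 240 ∧
    -- its optimal value is 132
    IsGreatest {m : ℤ | ∃ x : (hypercube 6).edgeSet → ℤ,
      IsFeasibleILP (hypercube 6) x ∧ ∑ e, x e = m} 132 ∧
    -- the upper bound, the construction, and the exact value
    exIn (hypercube 6) (SimpleGraph.cycleGraph 4) ≤ 132 ∧
    (∃ G : SimpleGraph (Fin 6 → Bool), G ≤ hypercube 6 ∧
      (SimpleGraph.cycleGraph 4).Free G ∧ G.edgeSet.ncard = 132) ∧
    exIn (hypercube 6) (SimpleGraph.cycleGraph 4) = 132 :=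
  ⟨SquareFree.card_edges, SquareFree.ncard_fourCycles, SquareFree.isGreatest_ilp,
    SquareFree.exIn_eq.le, SquareFree.exists_free, SquareFree.exIn_eq⟩
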